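/- **Setting.** *Lie algebra side.* Let $sl_2$ (over $\mathbb{C}$) have basis $h,e,f$ with $[h,e]=2e$, $[h,f]=-2f$, $[e,f]=h$, and let $\mathrm{Inv}(sl_2^{\otimes n})$ be the space of tensors killed by $h,e,f$. Put $c=\tfrac12 h\otimes h+f\otimes e+e\otimes f$, $b=h\otimes e\otimes f+e\otimes f\otimes h+f\otimes h\otimes e-h\otimes f\otimes e-f\otimes e\otimes h-e\otimes h\otimes f$, and let $\kappa$ be the symmetric bilinear form with $\kappa(h,h)=2$, $\kappa(e,f)=1$ and value $0$ on the other pairs of basis elements. *Riordan trees.* A Riordan partition of $\{1,\dots,n\}$ is a noncrossing partition all of whose parts have at least two elements. Its Riordan tree $T$ is the Jacobi diagram (unitrivalent graph with a cyclic ordering of the half-edges at each trivalent vertex) that is the disjoint union, over the parts $i_1<\dots<i_k$, of the ordered linear trees $i_1 - t_2 - \cdots - t_{k-1} - i_k$, in which the trivalent vertex $t_j$ carries a leg labeled $i_j$ and has the cyclic ordering (half-edge towards $i_1$, leg $i_j$, half-edge towards $i_k$); for $k=2$ this is a single edge (a strut). Let $\mathrm{tri}(T)$ be the number of trivalent vertices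 of $T$ and $\deg(T)$ half the number of all its vertices. The $sl_2$ weight system gives $W(T)\in sl_2^{\otimes n}$: put a copy of $c$ on each strut and a copy of $b$ on each trivalent vertex (following the cyclic ordering), and contract along each internal edge (edge between two trivalent vertices) by $\kappa$; the $i$-th tensor factor belongs to the univalent vertex labeled $i$. *Quantum side.* Over $\mathbb{C}(q)$, let $V_1$ have basis $v^{1},v^{-1}$, and let $V_2$ be the $3$-dimensional irreducible representation of $U_q(sl_2)$ with basis $v^2,v^0,v^{-2}$, where $$Ev^2=0,\quad Ev^0=v^2,\quad Ev^{-2}=[2]v^0,\quad Fv^2=[2]v^0,\quad Fv^0=v^{-2},\quad Fv^{-2}=0,\quad Kv^i=q^iv^i,$$ $[2]=q+q^{-1}$. Let $U_q(sl_2)$ act on $V_2^{\otimes n}$ through $E\mapsto E\otimes 1+K^{-1}\otimes E$, $F\mapsto F\otimes K+1\otimes F$, $K\mapsto K\otimes K$; $\mathrm{Inv}_{U_q}(V_2^{\otimes n})$ is the space of $x$ with $Ex=Fx=0$, $Kx=x$. Let $\delta_1(1)=v^1\otimes v^{-1}-q^{-1}v^{-1}\otimes v^1$; let $\pi_2\colon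 V_1\otimes V_1\to V_2$ be given by $v^{\pm1}\otimes v^{\pm1}\mapsto v^{\pm2}$, $v^1\otimes v^{-1}\mapsto q^{-1}v^0$, $v^{-1}\otimes v^1\mapsto v^0$; and let $p_2\in\mathrm{End}(V_1\otimes V_1)$ be the Jones–Wenzl projector: it fixes $v^{1}\otimes v^{1}$ and $v^{-1}\otimes v^{-1}$, and $p_2(v^1\otimes v^{-1})=\frac1{[2]}(q^{-1}v^1\otimes v^{-1}+v^{-1}\otimes v^1)$, $p_2(v^{-1}\otimes v^1)=\frac1{[2]}(v^1\otimes v^{-1}+q\,v^{-1}\otimes v^1)$. *The element $f(T)$.* Embed $T$ in the lower half-plane with the univalent vertex labeled $j$ at $(j,0)$ and with the trivalent vertices oriented compatibly. Replace each point $(j,0)$ by a box $\pi_2$ with two strands, and take the boundary of a neighbourhood of the tree: this is a system of disjoint arcs, each standing for a copy of $\delta_1$. Insert a copy of $p_2$ on the two strands running along each internal edge. The resulting diagram, read as a composition of the maps $1^{\otimes a}\otimes\delta_1\otimes1^{\otimes b}$, $1^{\otimes a}\otimes p_2\otimes 1^{\otimes b}$ and finally $\pi_2^{\otimes n}$, defines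 $f(T)\in V_2^{\otimes n}$. *The map $\rho$.* On the elements of $\mathrm{Inv}_{U_q}(V_2^{\otimes n})$ whose coordinates in the basis $v^{s_1}\otimes\cdots\otimes v^{s_n}$ are regular at $q=1$, let $\rho$ be the $\mathbb{C}$-linear map to $\mathrm{Inv}(sl_2^{\otimes n})$ defined by $q\mapsto 1$, $v^0\mapsto\frac12h$, $v^2\mapsto-e$, $v^{-2}\mapsto f$. **Proposition.** For every $n\ge 0$ and every Riordan tree $T$ of order $n$, the tensor $f(T)$ lies in $\mathrm{Inv}_{U_q}(V_2^{\otimes n})$, its coordinates are regular at $q=1$, and $$\rho\big(f(T)\big)=\frac{(-1)^{\deg(T)}}{2^{\mathrm{tri}(T)}}\,W(T).$$ -/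

import Mathlib

open scoped TensorProduct

namespace RiordanSl2

/-! ### The Lie algebra `sl₂` and its invariant tensors (ground field `ℂ`) -/

/-- Index set for the standard basis `h, e, f` of `sl₂`. -/
inductive Gen
  | h | e | f
  deriving DecidableEq

instance : Fintype Gen := ⟨{.h, .e, .f}, fun x => by cases x <;> simp⟩

/-- `sl₂` over `ℂ`: trace-free `2 × 2` matrices. -/
abbrev Sl2 : Type := LieAlgebra.SpecialLinear.sl (Fin 2) ℂ

/-- The standard basis elements of `sl₂`:
`[h, e] = 2 e`, `[h, f] = -2 f`, `[e, f] = h`. -/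
def gen : Gen → Sl2
  | .h => ⟨!![1, 0; 0, -1], LinearMap.mem_ker.2 (by simp [Matrix.trace_fin_two])⟩
  | .e => ⟨!![0, 1; 0, 0], LinearMap.mem_ker.2 (by simp [Matrix.trace_fin_two])⟩
  | .f => ⟨!![0, 0; 1, 0], LinearMap.mem_ker.2 (by simp [Matrix.trace_fin_two])⟩

theorem lie_h_e : ⁅gen .h, gen .e⁆ = (2 : ℂ) • gen .e := by
  apply Subtype.ext
  simp [gen, Ring.lie_def, one_add_one_eq_two]

theorem lie_h_f : ⁅gen .h, gen .f⁆ = (-2 : ℂ) • gen .f := by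
  apply Subtype.ext
  ext i j
  fin_cases i <;> fin_cases j <;> (simp [gen, Ring.lie_def]; try norm_num)

theorem lie_e_f : ⁅gen .e, gen .f⁆ = gen .h := by
  apply Subtype.ext
  simp [gen, Ring.lie_def]

/-- `sl₂^{⊗ n}`. -/
abbrev Sl2Pow (n : ℕ) : Type := ⨂[ℂ] _ : Fin n, Sl2

/-- The adjoint action of `x` on `sl₂^{⊗ n}` (as a derivation):
`∑ i, 1 ⊗ ⋯ ⊗ ad x ⊗ ⋯ ⊗ 1`. -/
noncomputable def sl2Act (n : ℕ) (x : Sl2) : Sl2Pow n →ₗ[ℂ] Sl2Pow n :=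
  ∑ i : Fin n, PiTensorProduct.map
    (fun j => if j = i then (LieAlgebra.ad ℂ Sl2 x : Sl2 →ₗ[ℂ] Sl2) else LinearMap.id)

/-- `Inv(sl₂^{⊗ n})`: the tensors that are mapped to zero by `h`, `e` and `f`. -/
noncomputable def invSl2 (n : ℕ) : Submodule ℂ (Sl2Pow n) :=
  ⨅ g : Gen, LinearMap.ker (sl2Act n (gen g))

/-- The values of the form `κ` on the basis `h, e, f`. -/
def kappa : Gen → Gen → ℂ
  | .h, .h => 2
  | .e, .f => 1
  | .f, .e => 1
  | _, _ => 0

/-- The coefficients of the Casimir tensor `c = ½ h ⊗ h + f ⊗ e + e ⊗ f`. -/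
noncomputable def casimir : Gen → Gen → ℂ
  | .h, .h => 1 / 2
  | .f, .e => 1
  | .e, .f => 1
  | _, _ => 0

/-- The coefficients of
`b = h⊗e⊗f + e⊗f⊗h + f⊗h⊗e - h⊗f⊗e - f⊗e⊗h - e⊗h⊗f`. -/
def bracketTensor : Gen → Gen → Gen → ℂ
  | .h, .e, .f => 1
  | .e, .f, .h => 1
  | .f, .h, .e => 1
  | .h, .f, .e => -1
  | .f, .e, .h => -1
  | .e, .h, .f => -1
  | _, _, _ => 0

/-! ### Jacobi diagrams -/

/-- A Jacobi diagram whose univalent vertices are labelled bijectively by `Fin n`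
(so that they are identified with `Fin n`).

`Tri` is the set of trivalent vertices and `Edge` the set of edges.  The half-edges are the pairs
`(x, k)` with `x` trivalent and `k : Fin 3`, the cyclic ordering at `x` being
`(x, 0), (x, 1), (x, 2)`, together with one half-edge for each univalent vertex.  An edge `t`
consists of the two half-edges `ends (t, false)` and `ends (t, true)`, each half-edge belonging to
exactly one edge.  Each connected component has at least one univalent vertex. -/
structure JacobiDiagram (n : ℕ) where
  Tri : Type
  Edge : Type
  [fintypeTri : Fintype Tri]
  [decEqTri : DecidableEq Tri]
  [fintypeEdge : Fintype Edge]
  ends : Edge × Bool → (Tri × Fin 3) ⊕ Fin n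
  ends_bijective : Function.Bijective ends
  connected_to_leg : ∀ x : Tri, ∃ i : Fin n,
    Relation.ReflTransGen
      (fun u v : Tri ⊕ Fin n => ∃ t : Edge, ∃ β : Bool,
        Sum.map Prod.fst id (ends (t, β)) = u ∧ Sum.map Prod.fst id (ends (t, !β)) = v)
      (Sum.inl x) (Sum.inr i)

attribute [instance] JacobiDiagram.fintypeTri JacobiDiagram.decEqTri JacobiDiagram.fintypeEdge

namespace JacobiDiagram

variable {n : ℕ} (D : JacobiDiagram n)

/-- The set of half-edges. -/
abbrev HalfEdge : Type := (D.Tri × Fin 3) ⊕ Fin n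

/-- The number of trivalent vertices. -/
def tri : ℕ := Fintype.card D.Tri

/-- The degree: half the number of vertices (trivalent and univalent). -/
def deg : ℕ := (Fintype.card D.Tri + n) / 2

/-- The number of vertices is even, so that no rounding takes place in `deg`. -/
theorem two_mul_deg : 2 * D.deg = D.tri + n := by
  have h := Fintype.card_of_bijective D.ends_bijective
  simp only [Fintype.card_prod, Fintype.card_bool, Fintype.card_sum, Fintype.card_fin] at h
  unfold deg tri
  omega

/-- Contribution of an edge joining the half-edges `a` and `b` when these carry the basis elements
`x` and `y`: an internal edge is contracted by `κ`, a strut carries the Casimir tensor `c`, and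
an edge from a trivalent to a univalent vertex transports the basis element to the latter. -/
noncomputable def edgeWeight (a b : D.HalfEdge) (x y : Gen) : ℂ :=
  match a, b with
  | .inl _, .inl _ => kappa x y
  | .inr _, .inr _ => casimir x y
  | _, _ => if x = y then 1 else 0

/-- The `sl₂` weight system: put a copy of `b` at each trivalent vertex (following the cyclic
ordering), contract the internal edges by `κ`, put a copy of `c` on each strut, and read off the
resulting tensor, the `i`-th factor being attached to the `i`-th univalent vertex.  The contraction
is written in the basis `h, e, f`, as a sum over all ways of decorating the half-edges
with basis elements. -/
noncomputable def weight : Sl2Pow n :=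
  ∑ σ : D.HalfEdge → Gen,
    ((∏ x : D.Tri, bracketTensor (σ (.inl (x, 0))) (σ (.inl (x, 1))) (σ (.inl (x, 2)))) *
      ∏ t : D.Edge, D.edgeWeight (D.ends (t, false)) (D.ends (t, true))
        (σ (D.ends (t, false))) (σ (D.ends (t, true)))) •
    ⨂ₜ[ℂ] i : Fin n, gen (σ (.inr i))

end JacobiDiagram

/-! ### Riordan partitions and Riordan trees -/

/-- A Riordan partition of `{1, …, n}` (modelled by `Fin n`): a partition into parts with at least
two elements, which is noncrossing, i.e. the convex hulls of the parts are disjoint when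
the points are arranged on a circle. -/
structure RiordanPartition (n : ℕ) extends Finpartition (Finset.univ : Finset (Fin n)) where
  two_le_card : ∀ A ∈ parts, 2 ≤ A.card
  noncrossing : ∀ A ∈ parts, ∀ B ∈ parts, A ≠ B →
    ¬ ∃ a b c d : Fin n, a < b ∧ b < c ∧ c < d ∧ a ∈ A ∧ b ∈ B ∧ c ∈ A ∧ d ∈ B

namespace RiordanPartition

variable {n : ℕ} (P : RiordanPartition n)

/-- `i` is the smallest element of its part. -/
def IsFirst (i : Fin n) : Prop := ∀ j ∈ P.part i, i ≤ j

/-- `i` is the largest element of its part. -/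
def IsLast (i : Fin n) : Prop := ∀ j ∈ P.part i, j ≤ i

instance (i : Fin n) : Decidable (P.IsFirst i) := by unfold IsFirst; infer_instance
instance (i : Fin n) : Decidable (P.IsLast i) := by unfold IsLast; infer_instance

theorem exists_gt {i : Fin n} (h : ¬ P.IsLast i) :
    ((P.part i).filter (fun j => i < j)).Nonempty := by
  simp only [IsLast, not_forall, not_le] at h
  obtain ⟨j, hj, hij⟩ := h
  exact ⟨j, Finset.mem_filter.2 ⟨hj, hij⟩⟩

/-- The successor of `i` inside its part (for `i` not the largest element). -/
def next (i : Fin n) (h : ¬ P.IsLast i) : Fin n :=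
  ((P.part i).filter (fun j => i < j)).min' (P.exists_gt h)

theorem next_mem (i : Fin n) (h : ¬ P.IsLast i) : P.next i h ∈ P.part i ∧ i < P.next i h :=
  Finset.mem_filter.1 (Finset.min'_mem _ (P.exists_gt h))

theorem next_le (i : Fin n) (h : ¬ P.IsLast i) {j : Fin n} (hj : j ∈ P.part i) (hij : i < j) :
    P.next i h ≤ j :=
  Finset.min'_le _ _ (Finset.mem_filter.2 ⟨hj, hij⟩)

theorem part_eq {i j : Fin n} (h : j ∈ P.part i) : P.part j = P.part i :=
  P.part_eq_of_mem (P.part_mem.2 (Finset.mem_univ i)) h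

theorem self_mem (i : Fin n) : i ∈ P.part i := P.mem_part (Finset.mem_univ i)

theorem next_not_first (i : Fin n) (h : ¬ P.IsLast i) : ¬ P.IsFirst (P.next i h) := by
  intro hf
  obtain ⟨h1, h2⟩ := P.next_mem i h
  exact absurd (hf i (by rw [P.part_eq h1]; exact P.self_mem i)) (not_le.2 h2)

theorem next_injective {i j : Fin n} (hi : ¬ P.IsLast i) (hj : ¬ P.IsLast j)
    (h : P.next i hi = P.next j hj) : i = j := by
  obtain ⟨h1, h2⟩ := P.next_mem i hi
  obtain ⟨h3, h4⟩ := P.next_mem j hj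
  have hp : P.part i = P.part j := by rw [← P.part_eq h1, ← P.part_eq h3, h]
  rcases lt_trichotomy i j with hlt | heq | hgt
  · have := P.next_le i hi (by rw [hp]; exact P.self_mem j) hlt
    rw [h] at this
    exact absurd this (not_le.2 h4)
  · exact heq
  · have := P.next_le j hj (by rw [← hp]; exact P.self_mem i) hgt
    rw [← h] at this
    exact absurd this (not_le.2 h2)

theorem exists_next_eq {i : Fin n} (h : ¬ P.IsFirst i) :
    ∃ j, ∃ hj : ¬ P.IsLast j, P.next j hj = i := by
  have hne : ((P.part i).filter (fun j => j < i)).Nonempty := by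
    simp only [IsFirst, not_forall, not_le] at h
    obtain ⟨j, hj, hij⟩ := h
    exact ⟨j, Finset.mem_filter.2 ⟨hj, hij⟩⟩
  set j := ((P.part i).filter (fun j => j < i)).max' hne with hjdef
  obtain ⟨h1, h2⟩ := Finset.mem_filter.1 (Finset.max'_mem _ hne)
  rw [← hjdef] at h1 h2
  have hpj : P.part j = P.part i := P.part_eq h1
  have hij : i ∈ P.part j := by rw [hpj]; exact P.self_mem i
  have hl : ¬ P.IsLast j := fun hl => absurd (hl i hij) (not_le.2 h2)
  refine ⟨j, hl, le_antisymm (P.next_le j hl hij h2) ?_⟩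
  by_contra hlt
  obtain ⟨h3, h4⟩ := P.next_mem j hl
  have := Finset.le_max' ((P.part i).filter (fun j => j < i)) (P.next j hl)
    (Finset.mem_filter.2 ⟨by rw [← hpj]; exact h3, not_le.1 hlt⟩)
  exact absurd this (not_le.2 h4)

/-- The trivalent vertices of the Riordan tree: in the ordered linear tree with labels
`i₁ < i₂ < ⋯ < i_k` the trivalent vertices are in one-to-one correspondence, through the leg that
they carry, with the labels `i₂, …, i_{k-1}`. -/
abbrev Inner : Type := {i : Fin n // ¬ P.IsFirst i ∧ ¬ P.IsLast i}

/-- The half-edge on the spine that leaves `i` towards the larger labels: half-edge number `2` of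
the trivalent vertex carrying the leg `i`, or the leaf `i` itself if `i` is the
smallest element of its part. -/
def rightEnd (i : Fin n) (h : ¬ P.IsLast i) : (P.Inner × Fin 3) ⊕ Fin n :=
  if h' : P.IsFirst i then .inr i else .inl (⟨i, h', h⟩, 2)

/-- The half-edge on the spine that leaves `i` towards the smaller labels: half-edge number `0` of
the trivalent vertex carrying the leg `i`, or the leaf `i` itself if `i` is the
largest element of its part. -/
def leftEnd (i : Fin n) (h : ¬ P.IsFirst i) : (P.Inner × Fin 3) ⊕ Fin n :=
  if h' : P.IsLast i then .inr i else .inl (⟨i, h, h'⟩, 0)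

/-- Edges of the Riordan tree and their half-edges.  For each trivalent vertex there is the
edge to its leg (attached to half-edge number `1`); for each `i` that is not the largest element of
its part there is the spine edge from `i` to the next element of the part. -/
def treeEnds : (P.Inner ⊕ {i : Fin n // ¬ P.IsLast i}) × Bool → (P.Inner × Fin 3) ⊕ Fin n
  | (.inl x, false) => .inl (x, 1)
  | (.inl x, true) => .inr x.1
  | (.inr i, false) => P.rightEnd i.1 i.2
  | (.inr i, true) => P.leftEnd (P.next i.1 i.2) (P.next_not_first i.1 i.2)

theorem not_last_of_first {i : Fin n} (h : P.IsFirst i) : ¬ P.IsLast i := by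
  intro hl
  have h2 := P.two_le_card _ (P.part_mem.2 (Finset.mem_univ i))
  have : P.part i ⊆ {i} := fun j hj => by
    rw [Finset.mem_singleton]; exact le_antisymm (hl j hj) (h j hj)
  have := Finset.card_le_card this
  simp at this
  omega

theorem treeEnds_injective : Function.Injective P.treeEnds := by
  rintro ⟨x | i, β⟩ ⟨y | j, γ⟩ h <;> cases β <;> cases γ <;>
    simp only [treeEnds, rightEnd, leftEnd] at h
  all_goals first | (split_ifs at h <;> simp at h) | simp at h
  · rw [h]
  · rw [Subtype.ext h]
  · rename_i hf
    exact absurd (by rwa [h]) x.2.1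
  · rename_i hl
    exact absurd (by rwa [h]) x.2.2
  · rename_i hf
    exact absurd (by rwa [← h]) y.2.1
  · rename_i hl
    exact absurd (by rwa [← h]) y.2.2
  · rw [Subtype.ext h]
  · rw [Subtype.ext h]
  · rename_i hf hl
    exact absurd (h ▸ hf) (P.next_not_first j.1 j.2)
  · rename_i hl hf
    exact absurd (h ▸ hf) (P.next_not_first i.1 i.2)
  · rw [Subtype.ext (P.next_injective i.2 j.2 h)]
  · rw [Subtype.ext (P.next_injective i.2 j.2 h)]

theorem treeEnds_surjective : Function.Surjective P.treeEnds := by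
  have hR : ∀ i (h : ¬ P.IsLast i), ∃ t, P.treeEnds t = P.rightEnd i h :=
    fun i h => ⟨(.inr ⟨i, h⟩, false), rfl⟩
  have hL : ∀ i (h : ¬ P.IsFirst i), ∃ t, P.treeEnds t = P.leftEnd i h := by
    intro i h
    obtain ⟨j, hj, rfl⟩ := P.exists_next_eq h
    exact ⟨(.inr ⟨j, hj⟩, true), rfl⟩
  rintro (⟨x, k⟩ | i)
  · fin_cases k
    · obtain ⟨t, ht⟩ := hL x.1 x.2.1
      exact ⟨t, by rw [ht, leftEnd, dif_neg x.2.2]; rfl⟩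
    · exact ⟨(.inl x, false), rfl⟩
    · obtain ⟨t, ht⟩ := hR x.1 x.2.2
      exact ⟨t, by rw [ht, rightEnd, dif_neg x.2.1]; rfl⟩
  · by_cases hf : P.IsFirst i
    · obtain ⟨t, ht⟩ := hR i (P.not_last_of_first hf)
      exact ⟨t, by rw [ht, rightEnd, dif_pos hf]⟩
    · by_cases hl : P.IsLast i
      · obtain ⟨t, ht⟩ := hL i hf
        exact ⟨t, by rw [ht, leftEnd, dif_pos hl]⟩
      · exact ⟨(.inl ⟨i, hf, hl⟩, true), rfl⟩

/-- The Riordan tree of a Riordan partition: the disjoint union, over the parts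
`i₁ < i₂ < ⋯ < i_k`, of the ordered linear trees
`i₁ — t₂ — t₃ — ⋯ — t_{k-1} — i_k` in which the trivalent vertex `t_j` carries the leg `i_j`;
the cyclic ordering at `t_j` is: half-edge towards `i₁`, leg `i_j`, half-edge towards `i_k`.
(A part with two elements gives a strut.) -/
def tree : JacobiDiagram n where
  Tri := P.Inner
  Edge := P.Inner ⊕ {i : Fin n // ¬ P.IsLast i}
  ends := P.treeEnds
  ends_bijective := ⟨P.treeEnds_injective, P.treeEnds_surjective⟩
  connected_to_leg := fun x =>
    ⟨x.1, Relation.ReflTransGen.single ⟨.inl x, false, rfl, rfl⟩⟩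

end RiordanPartition
/-! ### `U_q(sl₂)`: the representation `V₂` and its tensor powers -/

/-- The field `ℂ(q)`. -/
abbrev Kq : Type := RatFunc ℂ

/-- The indeterminate `q`. -/
noncomputable def q : Kq := RatFunc.X

/-- The quantum integer `[m] = (q^m - q^{-m}) / (q - q^{-1})`. -/
noncomputable def qInt (m : ℕ) : Kq := (q ^ m - (q⁻¹) ^ m) / (q - q⁻¹)

/-- The weights `2, 0, -2` of `V₂`. -/
inductive Wt
  | two | zero | negTwo
  deriving DecidableEq

instance : Fintype Wt := ⟨{.two, .zero, .negTwo}, fun x => by cases x <;> simp⟩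

/-- The weight as an integer. -/
def Wt.val : Wt → ℤ
  | .two => 2
  | .zero => 0
  | .negTwo => -2

/-- The representation `V₂`, as the `ℂ(q)`-vector space with basis the dual basis
`v², v⁰, v⁻²`. -/
abbrev V2 : Type := Wt → Kq

/-- The dual basis vectors `v^i` of `V₂`. -/
noncomputable def vUp (w : Wt) : V2 := Pi.single w 1

/-- The original basis vectors `v_i` of `V₂`: `v₂ = v²`, `v₀ = [2] v⁰`, `v₋₂ = v⁻²`. -/
noncomputable def vLow : Wt → V2
  | .two => vUp .two
  | .zero => qInt 2 • vUp .zero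
  | .negTwo => vUp .negTwo

/-- The linear map `V₂ → V₂` with prescribed values on the basis `v^i`. -/
noncomputable def V2.lift (g : Wt → V2) : V2 →ₗ[Kq] V2 := (Pi.basisFun Kq Wt).constr Kq g

/-- The action of `E` on `V₂`: `E v₋₂ = [1] v₀`, `E v₀ = [2] v₂`, `E v₂ = 0`
(here `v⁰ = [2]⁻¹ v₀`). -/
noncomputable def actE : V2 →ₗ[Kq] V2 :=
  V2.lift fun
    | .two => 0
    | .zero => (qInt 2)⁻¹ • qInt 2 • vLow .two
    | .negTwo => qInt 1 • vLow .zero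

/-- The action of `F` on `V₂`: `F v₂ = [1] v₀`, `F v₀ = [2] v₋₂`, `F v₋₂ = 0`
(here `v⁰ = [2]⁻¹ v₀`). -/
noncomputable def actF : V2 →ₗ[Kq] V2 :=
  V2.lift fun
    | .two => qInt 1 • vLow .zero
    | .zero => (qInt 2)⁻¹ • qInt 2 • vLow .negTwo
    | .negTwo => 0

/-- The action of `K` on `V₂`: `K v_i = q^i v_i`. -/
noncomputable def actK : V2 →ₗ[Kq] V2 := V2.lift fun w => q ^ w.val • vUp w

/-- The action of `K⁻¹` on `V₂`. -/
noncomputable def actKinv : V2 →ₗ[Kq] V2 := V2.lift fun w => q ^ (-w.val) • vUp w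

/-- `V₂^{⊗ n}`. -/
abbrev V2Pow (n : ℕ) : Type := ⨂[Kq] _ : Fin n, V2

/-- The action of `E` on `V₂^{⊗ n}` through the iterated comultiplication with
`Δ(E) = E ⊗ 1 + K⁻¹ ⊗ E`. -/
noncomputable def powE (n : ℕ) : V2Pow n →ₗ[Kq] V2Pow n :=
  ∑ i : Fin n, PiTensorProduct.map
    (fun j => if j = i then actE else if j < i then actKinv else LinearMap.id)

/-- The action of `F` on `V₂^{⊗ n}` through the iterated comultiplication with
`Δ(F) = F ⊗ K + 1 ⊗ F`. -/
noncomputable def powF (n : ℕ) : V2Pow n →ₗ[Kq] V2Pow n :=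
  ∑ i : Fin n, PiTensorProduct.map
    (fun j => if j = i then actF else if i < j then actK else LinearMap.id)

/-- The action of `K` on `V₂^{⊗ n}`, with `Δ(K) = K ⊗ K`. -/
noncomputable def powK (n : ℕ) : V2Pow n →ₗ[Kq] V2Pow n :=
  PiTensorProduct.map (fun _ => actK)

/-- The coordinates with respect to the basis `v^{s₁} ⊗ ⋯ ⊗ v^{sₙ}` of `V₂^{⊗ n}`. -/
noncomputable def coord {n : ℕ} (x : V2Pow n) (s : Fin n → Wt) : Kq :=
  (Basis.piTensorProduct (fun _ : Fin n => Pi.basisFun Kq Wt)).repr x s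

/-- `Inv_{U_q}(V₂^{⊗ n})`: the tensors `x` with `u x = ε(u) x` for the generators `E, F, K` (hence
for all `u`) of `U_q(sl₂)`. -/
noncomputable def invUq (n : ℕ) : Submodule Kq (V2Pow n) :=
  LinearMap.ker (powE n) ⊓ LinearMap.ker (powF n) ⊓ LinearMap.ker (powK n - LinearMap.id)

/-! ### The specialization `ρ` -/

/-- The rational function `r` is regular (has no pole) at `q = 1`. -/
def RegularAtOne (r : Kq) : Prop := Polynomial.eval₂ (RingHom.id ℂ) 1 r.denom ≠ 0

/-- The value at `q = 1` of a rational function that is regular there. -/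
noncomputable def valueAtOne (r : Kq) : ℂ := RatFunc.eval (RingHom.id ℂ) 1 r

theorem regular_zero : RegularAtOne 0 := by simp [RegularAtOne]
theorem regular_one : RegularAtOne 1 := by simp [RegularAtOne]
theorem regular_C (c : ℂ) : RegularAtOne (RatFunc.C c) := by simp [RegularAtOne]

theorem regular_of_dvd {r : Kq} {p : Polynomial ℂ} (h : r.denom ∣ p)
    (hp : Polynomial.eval₂ (RingHom.id ℂ) 1 p ≠ 0) : RegularAtOne r :=
  fun h0 => hp (Polynomial.eval₂_eq_zero_of_dvd_of_eval₂_eq_zero _ _ h h0)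

theorem regular_add {r s : Kq} (hr : RegularAtOne r) (hs : RegularAtOne s) :
    RegularAtOne (r + s) :=
  regular_of_dvd (RatFunc.denom_add_dvd r s) (by
    rw [Polynomial.eval₂_mul]; exact mul_ne_zero hr hs)

theorem regular_mul {r s : Kq} (hr : RegularAtOne r) (hs : RegularAtOne s) :
    RegularAtOne (r * s) :=
  regular_of_dvd (RatFunc.denom_mul_dvd r s) (by
    rw [Polynomial.eval₂_mul]; exact mul_ne_zero hr hs)

theorem regular_sum {ι : Type*} (S : Finset ι) (r : ι → Kq) (h : ∀ i, RegularAtOne (r i)) :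
    RegularAtOne (∑ i ∈ S, r i) ∧ valueAtOne (∑ i ∈ S, r i) = ∑ i ∈ S, valueAtOne (r i) := by
  classical
  induction S using Finset.induction_on with
  | empty => simpa [valueAtOne] using regular_zero
  | insert a S ha ih =>
    rw [Finset.sum_insert ha, Finset.sum_insert ha, ← ih.2]
    exact ⟨regular_add (h a) ih.1, RatFunc.eval_add _ _ (h a) ih.1⟩

theorem regular_prod {ι : Type*} (S : Finset ι) (r : ι → Kq) (h : ∀ i, RegularAtOne (r i)) :
    RegularAtOne (∏ i ∈ S, r i) ∧ valueAtOne (∏ i ∈ S, r i) = ∏ i ∈ S, valueAtOne (r i) := by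
  classical
  induction S using Finset.induction_on with
  | empty => simpa [valueAtOne] using regular_one
  | insert a S ha ih =>
    rw [Finset.prod_insert ha, Finset.prod_insert ha, ← ih.2]
    exact ⟨regular_mul (h a) ih.1, RatFunc.eval_mul _ _ (h a) ih.1⟩

theorem coord_add {n : ℕ} (x y : V2Pow n) (s : Fin n → Wt) :
    coord (x + y) s = coord x s + coord y s := by simp [coord]

theorem coord_smul {n : ℕ} (c : Kq) (x : V2Pow n) (s : Fin n → Wt) :
    coord (c • x) s = c * coord x s := by simp [coord]

theorem coord_tprod {n : ℕ} (v : Fin n → V2) (s : Fin n → Wt) :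
    coord (⨂ₜ[Kq] i, v i) s = ∏ i, v i (s i) := by
  simp [coord, Basis.piTensorProduct_repr_tprod_apply]

theorem C_smul_eq {n : ℕ} (c : ℂ) (x : V2Pow n) : c • x = (RatFunc.C c : Kq) • x := by
  induction x using PiTensorProduct.induction_on with
  | smul_tprod r f =>
    rw [← smul_assoc, ← smul_assoc, smul_eq_mul, RatFunc.smul_eq_C_mul]
  | add x y hx hy => rw [smul_add, smul_add, hx, hy]

theorem sum_coord {n : ℕ} (x : V2Pow n) :
    x = ∑ s : Fin n → Wt, coord x s • ⨂ₜ[Kq] i, vUp (s i) := by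
  conv_lhs => rw [← (Basis.piTensorProduct (fun _ : Fin n => Pi.basisFun Kq Wt)).sum_repr x]
  refine Finset.sum_congr rfl fun s _ => ?_
  rw [Basis.piTensorProduct_apply]
  simp [coord, vUp]

/-- The elements of `Inv_{U_q}(V₂^{⊗ n})` whose coordinates in the basis
`v^{s₁} ⊗ ⋯ ⊗ v^{sₙ}` are regular at `q = 1`; this is where the substitution `q = 1` makes sense. -/
noncomputable def invUqReg (n : ℕ) : Submodule ℂ (V2Pow n) where
  carrier := {x | x ∈ invUq n ∧ ∀ s, RegularAtOne (coord x s)}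
  add_mem' := fun hx hy => ⟨add_mem hx.1 hy.1, fun s => by
    rw [coord_add]; exact regular_add (hx.2 s) (hy.2 s)⟩
  zero_mem' := ⟨zero_mem _, fun s => by simpa [coord] using regular_zero⟩
  smul_mem' := fun c x hx => by
    rw [C_smul_eq]
    exact ⟨Submodule.smul_mem _ _ hx.1, fun s => by
      rw [coord_smul]; exact regular_mul (regular_C c) (hx.2 s)⟩

/-- The images of the basis vectors: `ρ(v²) = -e`, `ρ(v⁰) = ½ h`, `ρ(v⁻²) = f`. -/
noncomputable def rhoVec : Wt → Sl2
  | .two => -gen .e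
  | .zero => (1 / 2 : ℂ) • gen .h
  | .negTwo => gen .f

/-- The specialization on tensors: substitute `q = 1` in the coordinates and replace each
`v^i` by `ρ(v^i)`. -/
noncomputable def rhoTensor {n : ℕ} (x : V2Pow n) : Sl2Pow n :=
  ∑ s : Fin n → Wt, valueAtOne (coord x s) • ⨂ₜ[ℂ] i, rhoVec (s i)

theorem rhoTensor_map {n : ℕ} (A : Fin n → Fin n → V2 →ₗ[Kq] V2)
    (B : Fin n → Fin n → Sl2 →ₗ[ℂ] Sl2)
    (hreg : ∀ i j s t, RegularAtOne (A i j (vUp s) t))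
    (hval : ∀ i j s, ∑ t, valueAtOne (A i j (vUp s) t) • rhoVec t = B i j (rhoVec s))
    (x : V2Pow n) (hx : ∀ s, RegularAtOne (coord x s)) :
    rhoTensor ((∑ i, PiTensorProduct.map (A i)) x) =
      (∑ i, PiTensorProduct.map (B i)) (rhoTensor x) := by
  have hc : ∀ t, coord ((∑ i, PiTensorProduct.map (A i)) x) t =
      ∑ s, coord x s * ∑ i, ∏ j, A i j (vUp (s j)) (t j) := by
    intro t
    conv_lhs => rw [sum_coord x]
    simp only [map_sum, map_smul, LinearMap.sum_apply, PiTensorProduct.map_tprod]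
    have hlin : ∀ (S : Finset (Fin n → Wt)) (g : (Fin n → Wt) → V2Pow n),
        coord (∑ s ∈ S, g s) t = ∑ s ∈ S, coord (g s) t := by
      intro S g; simp [coord]
    have hlin' : ∀ (S : Finset (Fin n)) (g : Fin n → V2Pow n),
        coord (∑ s ∈ S, g s) t = ∑ s ∈ S, coord (g s) t := by
      intro S g; simp [coord]
    rw [hlin]
    refine Finset.sum_congr rfl fun s _ => ?_
    rw [coord_smul, hlin']
    simp only [coord_tprod]
  have hP : ∀ (i : Fin n) (s t : Fin n → Wt), RegularAtOne (∏ j, A i j (vUp (s j)) (t j)) ∧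
      valueAtOne (∏ j, A i j (vUp (s j)) (t j)) = ∏ j, valueAtOne (A i j (vUp (s j)) (t j)) :=
    fun i s t => regular_prod _ _ fun j => hreg i j _ _
  have hS : ∀ s t : Fin n → Wt, RegularAtOne (∑ i, ∏ j, A i j (vUp (s j)) (t j)) ∧
      valueAtOne (∑ i, ∏ j, A i j (vUp (s j)) (t j)) =
        ∑ i, valueAtOne (∏ j, A i j (vUp (s j)) (t j)) :=
    fun s t => regular_sum _ _ fun i => (hP i s t).1
  have hv : ∀ t, valueAtOne (coord ((∑ i, PiTensorProduct.map (A i)) x) t) =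
      ∑ s, valueAtOne (coord x s) * ∑ i, ∏ j, valueAtOne (A i j (vUp (s j)) (t j)) := by
    intro t
    rw [hc, (regular_sum _ _ fun s => regular_mul (hx s) (hS s t).1).2]
    refine Finset.sum_congr rfl fun s _ => ?_
    rw [valueAtOne, RatFunc.eval_mul _ _ (hx s) (hS s t).1]
    change valueAtOne _ * valueAtOne _ = _
    rw [(hS s t).2]
    simp only [(hP _ _ _).2]
  unfold rhoTensor
  simp only [hv]
  simp only [map_sum, map_smul, LinearMap.sum_apply, PiTensorProduct.map_tprod, ← hval]
  simp only [MultilinearMap.map_sum, MultilinearMap.map_smul_univ, Finset.sum_smul, mul_smul,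
    Finset.smul_sum]
  rw [Finset.sum_comm]
  refine Finset.sum_congr rfl fun s _ => ?_
  rw [Finset.sum_comm]

theorem q_ne_zero : q ≠ 0 := RatFunc.X_ne_zero

theorem q_sub_inv_ne_zero : q - q⁻¹ ≠ 0 := by
  intro h
  have h1 : q * q = 1 := by
    rw [sub_eq_zero] at h
    nth_rewrite 2 [h]
    exact mul_inv_cancel₀ q_ne_zero
  have h2 : (Polynomial.X * Polynomial.X : Polynomial ℂ) = 1 := by
    apply RatFunc.algebraMap_injective ℂ
    simpa [q] using h1
  have := congrArg Polynomial.natDegree h2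
  simp at this

theorem qInt_one : qInt 1 = 1 := by
  simp [qInt, div_self q_sub_inv_ne_zero]

theorem qInt_two : qInt 2 = q + q⁻¹ := by
  rw [qInt, div_eq_iff q_sub_inv_ne_zero]; ring

theorem regular_q : RegularAtOne q := by simp [RegularAtOne, q]

theorem value_q : valueAtOne q = 1 := by simp [valueAtOne, q]

theorem regular_inv {r : Kq} (hr : RegularAtOne r) (h : valueAtOne r ≠ 0) :
    RegularAtOne r⁻¹ ∧ valueAtOne r⁻¹ = (valueAtOne r)⁻¹ := by
  have hnum : Polynomial.eval₂ (RingHom.id ℂ) 1 r.num ≠ 0 := by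
    intro h0; exact h (by simp [valueAtOne, RatFunc.eval, h0])
  have hr0 : r ≠ 0 := by rintro rfl; simp [valueAtOne] at h
  have h1 : RegularAtOne r⁻¹ := regular_of_dvd (p := r.num) (by
    have := RatFunc.denom_div_dvd r.denom r.num
    rwa [← inv_div, RatFunc.num_div_denom] at this) hnum
  refine ⟨h1, ?_⟩
  have := RatFunc.eval_mul (RingHom.id ℂ) 1 hr h1
  rw [mul_inv_cancel₀ hr0, RatFunc.eval_one] at this
  exact eq_inv_of_mul_eq_one_right this.symm

theorem lift_vUp (g : Wt → V2) (w : Wt) : V2.lift g (vUp w) = g w := by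
  have := (Pi.basisFun Kq Wt).constr_basis Kq g w
  simpa [V2.lift, vUp] using this

theorem sum_wt {M : Type*} [AddCommMonoid M] (g : Wt → M) :
    ∑ w, g w = g .two + (g .zero + g .negTwo) := by
  change ∑ w ∈ ({.two, .zero, .negTwo} : Finset Wt), g w = _
  rw [Finset.sum_insert (by decide), Finset.sum_insert (by decide), Finset.sum_singleton]

theorem regular_qInt_two : RegularAtOne (q + q⁻¹) ∧ valueAtOne (q + q⁻¹) = 2 := by
  obtain ⟨h1, h2⟩ := regular_inv regular_q (by rw [value_q]; exact one_ne_zero)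
  refine ⟨regular_add regular_q h1, ?_⟩
  have := RatFunc.eval_add (RingHom.id ℂ) 1 regular_q h1
  change valueAtOne _ = valueAtOne _ + valueAtOne _ at this
  rw [this, h2, value_q]; norm_num

theorem qInt_two_ne_zero : q + q⁻¹ ≠ 0 := by
  intro h
  have := regular_qInt_two.2
  rw [h] at this
  simp [valueAtOne] at this

theorem regular_q_zpow (m : ℤ) : RegularAtOne (q ^ m) ∧ valueAtOne (q ^ m) = 1 := by
  have hn : ∀ k : ℕ, RegularAtOne (q ^ k) ∧ valueAtOne (q ^ k) = 1 := by
    intro k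
    have := regular_prod (Finset.range k) (fun _ => q) (fun _ => regular_q)
    simpa [value_q] using this
  cases m with
  | ofNat k => simpa using hn k
  | negSucc k =>
    have := regular_inv (hn (k + 1)).1 (by rw [(hn (k + 1)).2]; exact one_ne_zero)
    rw [zpow_negSucc]
    exact ⟨this.1, by rw [this.2, (hn (k + 1)).2, inv_one]⟩

theorem value_zero : valueAtOne 0 = 0 := by simp [valueAtOne]

theorem value_one : valueAtOne 1 = 1 := by simp [valueAtOne]

/-- The operator `A` on `V₂` is regular at `q = 1`, where it becomes `B` through `ρ`. -/
def Specializes (A : V2 →ₗ[Kq] V2) (B : Sl2 →ₗ[ℂ] Sl2) : Prop :=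
  (∀ s t, RegularAtOne (A (vUp s) t)) ∧
    ∀ s, ∑ t, valueAtOne (A (vUp s) t) • rhoVec t = B (rhoVec s)

theorem specializes_of_eq {A : V2 →ₗ[Kq] V2} {B : Sl2 →ₗ[ℂ] Sl2} (g : Wt → Wt → Kq)
    (hA : ∀ s t, A (vUp s) t = g s t)
    (hg : ∀ s t, RegularAtOne (g s t))
    (hB : ∀ s, ∑ t, valueAtOne (g s t) • rhoVec t = B (rhoVec s)) : Specializes A B :=
  ⟨fun s t => by rw [hA]; exact hg s t, fun s => by simpa only [hA] using hB s⟩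

theorem specializes_diag (A : V2 →ₗ[Kq] V2) (m : Wt → ℤ)
    (hA : ∀ s, A (vUp s) = q ^ m s • vUp s) : Specializes A LinearMap.id := by
  refine specializes_of_eq (fun s t => if t = s then q ^ m s else 0) ?_ ?_ ?_
  · intro s t
    rw [hA]
    simp [vUp, Pi.single_apply]
  · intro s t
    split_ifs
    · exact (regular_q_zpow _).1
    · exact regular_zero
  · intro s
    cases s <;> simp [sum_wt, value_zero, (regular_q_zpow _).2]

theorem specializes_E :
    Specializes actE (LieAlgebra.ad ℂ Sl2 (gen .e) : Sl2 →ₗ[ℂ] Sl2) := by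
  refine specializes_of_eq (fun
    | .zero, .two => 1
    | .negTwo, .zero => q + q⁻¹
    | _, _ => 0) ?_ ?_ ?_
  · intro s t
    rw [actE, lift_vUp]
    cases s <;> cases t <;>
      simp [vLow, vUp, qInt_one, qInt_two, qInt_two_ne_zero]
  · intro s t
    cases s <;> cases t <;> first
      | exact regular_zero | exact regular_one | exact regular_qInt_two.1
  · have h1 : ⁅gen .e, gen .h⁆ = -((2 : ℂ) • gen .e) := by rw [← lie_h_e, lie_skew]
    intro s
    cases s
    · simp [value_zero, rhoVec]
    · simp [sum_wt, value_zero, value_one, rhoVec, h1]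
    · simp [sum_wt, value_zero, regular_qInt_two.2, rhoVec, lie_e_f]

theorem specializes_F :
    Specializes actF (LieAlgebra.ad ℂ Sl2 (gen .f) : Sl2 →ₗ[ℂ] Sl2) := by
  refine specializes_of_eq (fun
    | .zero, .negTwo => 1
    | .two, .zero => q + q⁻¹
    | _, _ => 0) ?_ ?_ ?_
  · intro s t
    rw [actF, lift_vUp]
    cases s <;> cases t <;>
      simp [vLow, vUp, qInt_one, qInt_two, qInt_two_ne_zero]
  · intro s t
    cases s <;> cases t <;> first
      | exact regular_zero | exact regular_one | exact regular_qInt_two.1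
  · have h1 : ⁅gen .f, gen .h⁆ = (2 : ℂ) • gen .f := by
      rw [← lie_skew, lie_h_f]; simp
    have h2 : ⁅gen .f, gen .e⁆ = -gen .h := by rw [← lie_skew, lie_e_f]
    intro s
    cases s
    · simp [sum_wt, value_zero, regular_qInt_two.2, rhoVec, h2]
    · simp [sum_wt, value_zero, value_one, rhoVec, h1]
    · simp [value_zero, rhoVec]

theorem rhoTensor_zero {n : ℕ} : rhoTensor (0 : V2Pow n) = 0 := by
  simp [rhoTensor, coord, value_zero]

theorem q_zpow_eq_one {m : ℤ} (h : q ^ m = 1) : m = 0 := by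
  have hn : ∀ k : ℕ, q ^ k = 1 → k = 0 := by
    intro k hk
    have h2 : (Polynomial.X ^ k : Polynomial ℂ) = 1 := by
      apply RatFunc.algebraMap_injective ℂ
      simpa [q] using hk
    have := congrArg Polynomial.natDegree h2
    simpa using this
  cases m with
  | ofNat k => simpa using hn k (by simpa using h)
  | negSucc k =>
    rw [zpow_negSucc, inv_eq_one] at h
    exact absurd (hn _ h) (by omega)

theorem ad_h_rhoVec (w : Wt) : ⁅gen .h, rhoVec w⁆ = (w.val : ℂ) • rhoVec w := by
  cases w <;> simp [rhoVec, Wt.val, lie_h_e, lie_h_f]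

theorem weight_zero {n : ℕ} {x : V2Pow n} (hx : powK n x = x) (s : Fin n → Wt)
    (hs : coord x s ≠ 0) : ∑ i, (s i).val = 0 := by
  have h1 : coord (powK n x) s = (∏ i, q ^ (s i).val) * coord x s := by
    have hlin : ∀ (g : (Fin n → Wt) → V2Pow n), coord (∑ t, g t) s = ∑ t, coord (g t) s := by
      intro g; simp [coord]
    conv_lhs => rw [sum_coord x]
    simp only [map_sum, map_smul, powK, PiTensorProduct.map_tprod, actK, lift_vUp]
    rw [hlin, Finset.sum_eq_single s]
    · rw [coord_smul, coord_tprod, mul_comm]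
      simp [vUp]
    · intro t _ hts
      obtain ⟨i, hi⟩ := Function.ne_iff.1 hts
      rw [coord_smul, coord_tprod, Finset.prod_eq_zero (Finset.mem_univ i), mul_zero]
      simp [vUp, hi.symm]
    · simp
  rw [hx] at h1
  have h2 : ∏ i, q ^ (s i).val = 1 := (mul_eq_right₀ hs).1 h1.symm
  have h3 : ∏ i, q ^ (s i).val = q ^ (∑ i, (s i).val) := by
    classical
    induction (Finset.univ : Finset (Fin n)) using Finset.induction_on with
    | empty => simp
    | insert a S ha ih => rw [Finset.prod_insert ha, Finset.sum_insert ha, ih,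
        zpow_add₀ q_ne_zero]
  exact q_zpow_eq_one (h3 ▸ h2)

theorem sl2Act_h_tprod {n : ℕ} (s : Fin n → Wt) :
    sl2Act n (gen .h) (⨂ₜ[ℂ] i, rhoVec (s i)) =
      ((∑ i, (s i).val : ℤ) : ℂ) • ⨂ₜ[ℂ] i, rhoVec (s i) := by
  simp only [sl2Act, LinearMap.sum_apply, PiTensorProduct.map_tprod]
  push_cast
  rw [Finset.sum_smul]
  refine Finset.sum_congr rfl fun i _ => ?_
  have h1 : (fun j => (if j = i then (LieAlgebra.ad ℂ Sl2 (gen .h) : Sl2 →ₗ[ℂ] Sl2)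
      else LinearMap.id) (rhoVec (s j))) =
      Function.update (fun j => rhoVec (s j)) i (((s i).val : ℂ) • rhoVec (s i)) := by
    funext j
    by_cases hj : j = i
    · subst hj; simp [ad_h_rhoVec]
    · simp [hj]
  rw [h1, MultilinearMap.map_update_smul]
  simp

/-- `ρ` sends invariant tensors to invariant tensors. -/
theorem rhoTensor_mem {n : ℕ} {x : V2Pow n} (hx : x ∈ invUqReg n) : rhoTensor x ∈ invSl2 n := by
  obtain ⟨⟨⟨hE, hF⟩, hK⟩, hr⟩ := hx
  have hE : powE n x = 0 := hE
  have hF : powF n x = 0 := hF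
  have hK : powK n x = x := sub_eq_zero.1 hK
  have hid : Specializes LinearMap.id LinearMap.id :=
    specializes_diag _ (fun _ => 0) (by simp)
  have key : ∀ (A : Fin n → Fin n → V2 →ₗ[Kq] V2) (B : Fin n → Fin n → Sl2 →ₗ[ℂ] Sl2),
      (∀ i j, Specializes (A i j) (B i j)) → (∑ i, PiTensorProduct.map (A i)) x = 0 →
      (∑ i, PiTensorProduct.map (B i)) (rhoTensor x) = 0 := by
    intro A B hAB h0
    rw [← rhoTensor_map A B (fun i j => (hAB i j).1) (fun i j => (hAB i j).2) x hr, h0,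
      rhoTensor_zero]
  simp only [invSl2, Submodule.mem_iInf, LinearMap.mem_ker]
  rintro (_ | _ | _)
  · unfold rhoTensor
    rw [map_sum]
    refine Finset.sum_eq_zero fun s _ => ?_
    rw [map_smul, sl2Act_h_tprod]
    by_cases hs : coord x s = 0
    · rw [hs, value_zero, zero_smul]
    · rw [weight_zero hK s hs]; simp
  · refine key _ _ (fun i j => ?_) hE
    split_ifs
    · exact specializes_E
    · exact specializes_diag _ (fun w => -w.val) fun s => by rw [actKinv, lift_vUp]
    · exact hid
  · refine key _ _ (fun i j => ?_) hF
    split_ifs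
    · exact specializes_F
    · exact specializes_diag _ (fun w => w.val) fun s => by rw [actK, lift_vUp]
    · exact hid

/-- The specialization map `ρ : Inv_{U_q}(V₂^{⊗ n}) → Inv(sl₂^{⊗ n})`: the `ℂ`-linear map with
`q ↦ 1`, `v⁰ ↦ ½ h`, `v² ↦ -e`, `v⁻² ↦ f`, defined on the invariant tensors whose
coordinates are regular at `q = 1`. -/
noncomputable def rho (n : ℕ) : invUqReg n →ₗ[ℂ] invSl2 n where
  toFun x := ⟨rhoTensor x.1, rhoTensor_mem x.2⟩
  map_add' x y := by
    apply Subtype.ext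
    change rhoTensor (x.1 + y.1) = rhoTensor x.1 + rhoTensor y.1
    unfold rhoTensor
    rw [← Finset.sum_add_distrib]
    refine Finset.sum_congr rfl fun s _ => ?_
    rw [← add_smul, coord_add]
    exact congrArg (· • _) (RatFunc.eval_add _ _ (x.2.2 s) (y.2.2 s))
  map_smul' c x := by
    apply Subtype.ext
    change rhoTensor (c • x.1) = c • rhoTensor x.1
    unfold rhoTensor
    rw [Finset.smul_sum]
    refine Finset.sum_congr rfl fun s _ => ?_
    rw [C_smul_eq, coord_smul, ← smul_assoc]
    refine congrArg (· • _) ?_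
    have := RatFunc.eval_mul (RingHom.id ℂ) 1 (regular_C c) (x.2.2 s)
    rw [RatFunc.eval_C] at this
    exact this

/-! ### The graphical calculus for invariant tensors -/

/-- The two basis vectors `v¹` and `v⁻¹` of `V₁`. -/
inductive Spin
  | up | down
  deriving DecidableEq

/-- `⊕ₖ V₁^{⊗ k}`: formal linear combinations of words, the word `a₁ a₂ … aₖ` standing for
`v^{a₁} ⊗ v^{a₂} ⊗ ⋯ ⊗ v^{aₖ}`. -/
abbrev V1Tensor : Type := List Spin →₀ Kq

/-- `δ₁(1) = v¹ ⊗ v⁻¹ - q⁻¹ v⁻¹ ⊗ v¹`. -/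
noncomputable def delta1 : V1Tensor :=
  Finsupp.single [.up, .down] 1 - Finsupp.single [.down, .up] q⁻¹

/-- The Jones-Wenzl projector `p₂` on the basis of `V₁ ⊗ V₁`. -/
noncomputable def jonesWenzl : Spin → Spin → V1Tensor
  | .up, .up => Finsupp.single [.up, .up] 1
  | .up, .down => (qInt 2)⁻¹ •
      (Finsupp.single [.up, .down] q⁻¹ + Finsupp.single [.down, .up] 1)
  | .down, .up => (qInt 2)⁻¹ •
      (Finsupp.single [.up, .down] 1 + Finsupp.single [.down, .up] q)
  | .down, .down => Finsupp.single [.down, .down] 1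

/-- `x ↦ u ⊗ x ⊗ w` for words `u`, `w`. -/
noncomputable def sandwich (u w : List Spin) (x : V1Tensor) : V1Tensor :=
  x.mapDomain (fun m => u ++ m ++ w)

/-- The elementary map `(δ₁)_l = 1^{⊗ l} ⊗ δ₁ ⊗ 1^{⊗ (k - l)} : V₁^{⊗ k} → V₁^{⊗ (k + 2)}`:
a new arc is inserted to the right of the first `l` strands. -/
noncomputable def cupAt (l : ℕ) : V1Tensor →ₗ[Kq] V1Tensor :=
  Finsupp.linearCombination Kq fun w => sandwich (w.take l) (w.drop l) delta1

/-- The elementary map `1^{⊗ l} ⊗ p₂ ⊗ 1^{⊗ (k - l - 2)} : V₁^{⊗ k} → V₁^{⊗ k}`: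
a Jones-Wenzl projector is inserted on the strands number `l + 1` and `l + 2`
(`0` if there are no such strands). -/
noncomputable def jwAt (l : ℕ) : V1Tensor →ₗ[Kq] V1Tensor :=
  Finsupp.linearCombination Kq fun w =>
    match w.drop l with
    | a :: b :: w' => sandwich (w.take l) w' (jonesWenzl a b)
    | _ => 0

/-- `π₂ : V₁ ⊗ V₁ → V₂` on the basis. -/
noncomputable def pi2 : Spin → Spin → V2
  | .up, .up => vUp .two
  | .up, .down => q⁻¹ • vUp .zero
  | .down, .up => vUp .zero
  | .down, .down => vUp .negTwo

/-- `π₂^{⊗ n} : V₁^{⊗ 2n} → V₂^{⊗ n}` (words of another length are sent to `0`). -/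
noncomputable def piPow (n : ℕ) : V1Tensor →ₗ[Kq] V2Pow n :=
  Finsupp.linearCombination Kq fun w =>
    if h : w.length = 2 * n then
      ⨂ₜ[Kq] i : Fin n, pi2 (w[2 * i.1]'(by omega)) (w[2 * i.1 + 1]'(by omega))
    else 0

/-- The diagram of an ordered linear tree with `k ≥ 2` leaves, inserted to the right of the first
`l` strands, read from bottom to top.

The boundary of a neighbourhood of the strut consists of two nested arcs; this gives two pairs of
strands.  The last pair of strands then runs along the part of the spine that leads to the remaining
leaves.  Passing from `k` to `k + 1` leaves, this pair reaches a new trivalent vertex, where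
the boundary of the neighbourhood gets a new arc, inserted in the middle of the pair.  If `k ≥ 3`
the pair comes from a trivalent vertex too, so that it runs along an internal edge, and
a Jones-Wenzl projector is inserted on it. -/
noncomputable def linearTreeDiagram (l : ℕ) : ℕ → (V1Tensor →ₗ[Kq] V1Tensor)
  | 0 => LinearMap.id
  | 1 => LinearMap.id
  | 2 => cupAt (l + 1) ∘ₗ cupAt l
  | 3 => cupAt (l + 3) ∘ₗ linearTreeDiagram l 2
  | k + 4 => cupAt (l + 2 * k + 5) ∘ₗ jwAt (l + 2 * k + 4) ∘ₗ linearTreeDiagram l (k + 3)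

/-- The tensor in `V₁^{⊗ 2n}` of the diagram of the Riordan tree of `P`, before the boxes `π₂` are
applied.  The parts are treated in the order of their smallest elements.  When the
part with smallest element `i` (with `i : Fin n` counted from `0`) is treated, its diagram is
inserted to the right of the `2 i` strands that end in the boxes to the left of `i`; the
strands to the right of it end in boxes beyond the whole part, since the partition is
noncrossing. -/
noncomputable def treeStrands {n : ℕ} (P : RiordanPartition n) : V1Tensor :=
  (List.finRange n).foldl
    (fun x i => if P.IsFirst i then linearTreeDiagram (2 * i.1) (P.part i).card x else x)
    (Finsupp.single [] 1)

/-- The element `f(T)` of `V₂^{⊗ n}` for the Riordan tree `T` of the Riordan partition `P`: replace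
the `n` univalent vertices of the planar embedding of `T` by boxes `π₂`, take the boundary of
a neighbourhood of the tree, and insert a Jones-Wenzl projector at each internal edge. -/
noncomputable def fElement {n : ℕ} (P : RiordanPartition n) : V2Pow n :=
  piPow n (treeStrands P)

end RiordanSl2

/-!
The argument computes the coordinates of `f(T)` and of `W(T)` as products over the parts of the
partition, each factor being an entry of a product of `3 × 3` matrices, and compares the matrices.

*Quantum side.* Through the boxes `π₂` the diagrams act on coefficients of words in the basis of
`V₂`: two nested arcs insert an invariant tensor `strutQ` of `V₂ ⊗ V₂` (`boxCoeff_strut`), and a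
projector `p₂` followed by an arc in its middle is an intertwiner `V₂ → V₂ ⊗ V₂`, namely `vertexQ`
(`boxCoeff_vertex`).  At the first trivalent vertex of a tree there is no projector, but the boxes
at the other end of the two nested arcs make it superfluous (`boxCoeff_tripod`).  Hence a linear
tree multiplies coefficients by an entry of `strutQ * vertexQ x₂ * ⋯ * vertexQ x_{k-1}`
(`boxCoeff_linearTreeDiagram`).  As the partition is noncrossing, the strands of a part are
consecutive when the part is drawn, so that the coordinates of `f(T)` are the products of these
entries over all parts (`RiordanPartition.coord_fElement`).

*Invariance.* The action of `E` and `F` on coefficients is the recursion `wordAct`, which obeys a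
rule for concatenated words.  Since `strutQ` is invariant and `vertexQ` is equivariant, linear trees
are invariant of weight zero (`wordAct_chain`, `prod_mul_chain`), and inserting an invariant tensor
of weight zero into an invariant tensor gives an invariant tensor (`wordAct_insert`).

*Lie algebra side.* The state sum `W(T)` is summed over the states of the trivalent vertices part
by part, and from right to left inside a part (`RiordanPartition.sumOver_part`,
`RiordanPartition.sumOver_parts`).  The result has the same shape, with `c` in place of `strutQ` and
`b`, contracted with `κ` along the spine edge, in place of `vertexQ`
(`RiordanPartition.weight_tree`); the first spine edge fits into this pattern because `c` is inverse
to `κ` (`strutW_mul_vertexW`).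

*Comparison.* At `q = 1`, after the rescaling of the basis prescribed by `ρ`, the matrix `strutQ`
becomes `-c` and `vertexQ` becomes `-½ b` (`hasValueAtOne_strutQ`, `hasValueAtOne_vertexQ`).
The sign is therefore `(-1)` to the number of parts plus the number of trivalent vertices, which is
the degree (`RiordanPartition.deg_tree`).
-/

namespace RiordanSl2

/-! ### Linear chains of matrices -/

/-- The contraction of an ordered linear tree: for a word `a x₂ … x_{k-1} b`, the entry `(a, b)` of
`S * M x₂ * ⋯ * M x_{k-1}`, where `S` belongs to the strut and `M x` to a trivalent vertex whose leg
carries `x`.  Words with fewer than two letters have the value `0`. -/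
def chain {α R : Type*} [Fintype α] [DecidableEq α] [CommRing R] (S : Matrix α α R)
    (M : α → Matrix α α R) : List α → R
  | a :: b :: l => (S * ((b :: l).dropLast.map M).prod) a ((b :: l).getLast (by simp))
  | _ => 0

theorem chain_eq {α R : Type*} [Fintype α] [DecidableEq α] [CommRing R] (S : Matrix α α R)
    (M : α → Matrix α α R) (a b : α) (m : List α) :
    chain S M (a :: (m ++ [b])) = (S * (m.map M).prod) a b := by
  have key : ∀ (l : List α) (h : l ≠ []), l = m ++ [b] →
      (S * (l.dropLast.map M).prod) a (l.getLast h) = (S * (m.map M).prod) a b := by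
    rintro _ h rfl
    simp
  cases m with
  | nil => simp [chain]
  | cons x m => exact key (x :: (m ++ [b])) (by simp) rfl

theorem chain_pair {α R : Type*} [Fintype α] [DecidableEq α] [CommRing R] (S : Matrix α α R)
    (M : α → Matrix α α R) (a b : α) : chain S M [a, b] = S a b := by
  simp [chain]

theorem chain_snoc {α R : Type*} [Fintype α] [DecidableEq α] [CommRing R] (S : Matrix α α R)
    (M : α → Matrix α α R) (a x b : α) (m : List α) :
    chain S M (a :: (m ++ [x, b])) = ∑ t, chain S M (a :: (m ++ [t])) * M x t b := by
  have h : m ++ [x, b] = (m ++ [x]) ++ [b] := by simp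
  rw [h, chain_eq]
  simp only [chain_eq]
  rw [List.map_append, List.prod_append, ← Matrix.mul_assoc]
  simp [Matrix.mul_apply]

/-- A list with at least two elements consists of a first letter, a middle part and a last
letter. -/
theorem exists_ends {α : Type*} {l : List α} (h : 2 ≤ l.length) :
    ∃ a m b, l = a :: (m ++ [b]) := by
  match l, h with
  | a :: b :: l, _ =>
    exact ⟨a, (b :: l).dropLast, (b :: l).getLast (by simp),
      by rw [List.dropLast_append_getLast]⟩

/-! ### Coefficients of diagrams after the boxes `π₂` -/

/-- The coefficient of `v^{t₁} ⊗ ⋯ ⊗ v^{tₖ}` in the image of a basis word of `V₁^{⊗ 2k}` under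
`π₂^{⊗ k}`; it is `0` if the lengths do not fit. -/
noncomputable def boxWordCoeff : List Spin → List Wt → Kq
  | [], [] => 1
  | a :: b :: v, t :: w => pi2 a b t * boxWordCoeff v w
  | _, _ => 0

theorem boxWordCoeff_append {v : List Spin} {w : List Wt} (h : v.length = 2 * w.length)
    (v' : List Spin) (w' : List Wt) :
    boxWordCoeff (v ++ v') (w ++ w') = boxWordCoeff v w * boxWordCoeff v' w' := by
  induction w generalizing v with
  | nil =>
    obtain rfl : v = [] := by simpa using h
    simp [boxWordCoeff]
  | cons t w ih =>
    match v, h with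
    | [], h => simp at h
    | [a], h => simp at h; omega
    | a :: b :: v, h =>
      simp only [List.cons_append, boxWordCoeff]
      rw [ih (by simp at h; omega), mul_assoc]

theorem boxWordCoeff_eq_zero {v : List Spin} {w : List Wt} (h : v.length ≠ 2 * w.length) :
    boxWordCoeff v w = 0 := by
  induction w generalizing v with
  | nil =>
    match v, h with
    | [], h => simp at h
    | [a], h => simp [boxWordCoeff]
    | a :: b :: v, h => simp [boxWordCoeff]
  | cons t w ih =>
    match v, h with
    | [], h => simp [boxWordCoeff]
    | [a], h => simp [boxWordCoeff]
    | a :: b :: v, h =>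
      simp only [boxWordCoeff]
      rw [ih (by simp at h; omega), mul_zero]

/-- The coefficient of the word `w` in the image of a tensor under the boxes `π₂`, as a linear
form on `⊕ₖ V₁^{⊗ k}`. -/
noncomputable def boxCoeff (w : List Wt) : V1Tensor →ₗ[Kq] Kq :=
  Finsupp.linearCombination Kq fun v => boxWordCoeff v w

theorem boxCoeff_single (w : List Wt) (v : List Spin) (c : Kq) :
    boxCoeff w (Finsupp.single v c) = c * boxWordCoeff v w := by
  simp [boxCoeff, Finsupp.linearCombination_single]

theorem cupAt_single (l : ℕ) (v : List Spin) (c : Kq) :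
    cupAt l (Finsupp.single v c) = Finsupp.single (v.take l ++ .up :: .down :: v.drop l) c -
      Finsupp.single (v.take l ++ .down :: .up :: v.drop l) (c * q⁻¹) := by
  rw [cupAt, Finsupp.linearCombination_single, sandwich, delta1, sub_eq_add_neg,
    ← Finsupp.single_neg, Finsupp.mapDomain_add, Finsupp.mapDomain_single, Finsupp.mapDomain_single,
    smul_add, Finsupp.smul_single, Finsupp.smul_single, smul_eq_mul, smul_eq_mul, mul_neg, mul_one,
    Finsupp.single_neg, ← sub_eq_add_neg]
  simp

theorem cupAt_single_append {l : ℕ} {v : List Spin} (h : v.length = l) (v' : List Spin) (c : Kq) :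
    cupAt l (Finsupp.single (v ++ v') c) = Finsupp.single (v ++ .up :: .down :: v') c -
      Finsupp.single (v ++ .down :: .up :: v') (c * q⁻¹) := by
  subst h
  simp [cupAt_single]

theorem boxCoeff_cupAt_eq_zero {l : ℕ} {v : List Spin} {w : List Wt} (c : Kq)
    (h : v.length + 2 ≠ 2 * w.length) : boxCoeff w (cupAt l (Finsupp.single v c)) = 0 := by
  rw [cupAt_single, map_sub, boxCoeff_single, boxCoeff_single, boxWordCoeff_eq_zero,
    boxWordCoeff_eq_zero]
  · simp
  all_goals
    simp only [List.length_append, List.length_cons, List.length_take, List.length_drop]; omega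

/-- The coefficients of the invariant tensor of `V₂ ⊗ V₂` given by a strut (two nested arcs followed
by the boxes `π₂`). -/
noncomputable def strutQ : Matrix Wt Wt Kq
  | .two, .negTwo => 1
  | .zero, .zero => -q⁻¹ * (1 + q⁻¹ ^ 2)
  | .negTwo, .two => q⁻¹ ^ 2
  | _, _ => 0

/-- The trivalent vertex as an intertwiner `V₂ → V₂ ⊗ V₂`: the projector `p₂` embeds `V₂` into
`V₁ ⊗ V₁`, an arc is inserted in the middle, and the boxes `π₂` are applied.  The entry `(t, y)`
of the matrix `vertexQ x` is the coefficient of `v^x ⊗ v^y` in the image of `v^t`. -/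
noncomputable def vertexQ : Wt → Matrix Wt Wt Kq
  | .zero, .two, .two => -q⁻¹ ^ 2
  | .two, .two, .zero => 1
  | .two, .zero, .negTwo => (q + q⁻¹)⁻¹
  | .zero, .zero, .zero => (q + q⁻¹)⁻¹ * (q - q⁻¹ ^ 3)
  | .negTwo, .zero, .two => -(q + q⁻¹)⁻¹
  | .zero, .negTwo, .negTwo => 1
  | .negTwo, .negTwo, .zero => -q⁻¹ ^ 2
  | _, _, _ => 0

theorem q_sq_add_one_ne_zero : q ^ 2 + 1 ≠ 0 := by
  have h : q ^ 2 + 1 = q * (q + q⁻¹) := by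
    rw [mul_add, mul_inv_cancel₀ q_ne_zero]; ring
  rw [h]
  exact mul_ne_zero q_ne_zero qInt_two_ne_zero

theorem boxWordCoeff_mid (v₁ v v₂ : List Spin) (w₁ w w₂ : List Wt)
    (h₁ : v₁.length = 2 * w₁.length) (h : v.length = 2 * w.length) :
    boxWordCoeff (v₁ ++ (v ++ v₂)) (w₁ ++ (w ++ w₂)) =
      boxWordCoeff v w * (boxWordCoeff v₁ w₁ * boxWordCoeff v₂ w₂) := by
  rw [boxWordCoeff_append h₁, boxWordCoeff_append h]; ring

theorem boxCoeff_strut (w₁ w₂ : List Wt) (a b : Wt) (y : V1Tensor) :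
    boxCoeff (w₁ ++ a :: b :: w₂) (cupAt (2 * w₁.length + 1) (cupAt (2 * w₁.length) y)) =
      strutQ a b * boxCoeff (w₁ ++ w₂) y := by
  induction y using Finsupp.induction_linear with
  | zero => simp
  | add x y hx hy => rw [map_add, map_add, map_add, map_add, hx, hy, mul_add]
  | single v c =>
    by_cases hv : v.length = 2 * (w₁ ++ w₂).length
    · obtain ⟨v₁, v₂, rfl, h₁⟩ : ∃ v₁ v₂, v = v₁ ++ v₂ ∧ v₁.length = 2 * w₁.length := by
        refine ⟨v.take (2 * w₁.length), v.drop (2 * w₁.length), by simp, ?_⟩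
        rw [List.length_take, hv, List.length_append]; omega
      have hs : ∀ (x : Spin) (u : List Spin), v₁ ++ x :: u = (v₁ ++ [x]) ++ u := by simp
      have hl : ∀ x : Spin, (v₁ ++ [x]).length = 2 * w₁.length + 1 := by simp [h₁]
      rw [cupAt_single_append h₁, map_sub, hs .up, hs .down, cupAt_single_append (hl _),
        cupAt_single_append (hl _)]
      simp only [map_sub, boxCoeff_single, List.append_assoc]
      have hm : ∀ a' b' c' d' : Spin,
          boxWordCoeff (v₁ ++ ([a'] ++ b' :: c' :: d' :: v₂)) (w₁ ++ a :: b :: w₂) =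
          boxWordCoeff [a', b', c', d'] [a, b] * (boxWordCoeff v₁ w₁ * boxWordCoeff v₂ w₂) :=
        fun a' b' c' d' => boxWordCoeff_mid v₁ [a', b', c', d'] v₂ w₁ [a, b] w₂ h₁ rfl
      rw [hm, hm, hm, hm, boxWordCoeff_append h₁]
      cases a <;> cases b <;> simp [boxWordCoeff, strutQ, pi2, vUp] <;> ring
    -- A word whose length does not fit contributes `0` to both sides.
    · rw [boxCoeff_single, boxWordCoeff_eq_zero hv, cupAt_single, map_sub, map_sub,
        boxCoeff_cupAt_eq_zero, boxCoeff_cupAt_eq_zero]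
      · simp
      all_goals
        simp only [List.length_append, List.length_cons, List.length_take, List.length_drop] at hv ⊢
        omega

theorem jwAt_single_append {l : ℕ} {v : List Spin} (h : v.length = l) (a b : Spin)
    (v' : List Spin) (c : Kq) :
    jwAt l (Finsupp.single (v ++ a :: b :: v') c) = c • sandwich v v' (jonesWenzl a b) := by
  subst h
  simp [jwAt, Finsupp.linearCombination_single]

theorem boxCoeff_cupAt_jwAt_eq_zero {l l' : ℕ} {v : List Spin} {w : List Wt} (c : Kq)
    (h : v.length + 2 ≠ 2 * w.length) :
    boxCoeff w (cupAt l' (jwAt l (Finsupp.single v c))) = 0 := by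
  have hz : ∀ (u u' : List Spin) (a b : Spin) (d : Kq), u.length + u'.length + 4 ≠ 2 * w.length →
      boxCoeff w (cupAt l' (d • sandwich u u' (jonesWenzl a b))) = 0 := by
    intro u u' a b d hd
    have : ∀ (x y : Spin) (e : Kq),
        boxCoeff w (cupAt l' (Finsupp.single (u ++ [x, y] ++ u') e)) = 0 := fun x y e =>
      boxCoeff_cupAt_eq_zero _ (by
        simp only [List.length_append, List.length_cons, List.length_nil]; omega)
    cases a <;> cases b <;>
      simp only [jonesWenzl, sandwich, Finsupp.mapDomain_add, Finsupp.mapDomain_smul,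
        Finsupp.mapDomain_single, map_add, map_smul, this] <;> simp
  rw [jwAt, Finsupp.linearCombination_single]
  split
  · rename_i a b w' hw
    apply hz
    have := congrArg List.length hw
    rw [List.length_drop, List.length_cons, List.length_cons] at this
    rw [List.length_take]
    omega
  · simp

theorem boxCoeff_vertex (w₁ w₂ : List Wt) (a b : Wt) (y : V1Tensor) :
    boxCoeff (w₁ ++ a :: b :: w₂) (cupAt (2 * w₁.length + 1) (jwAt (2 * w₁.length) y)) =
      ∑ t, vertexQ a t b * boxCoeff (w₁ ++ t :: w₂) y := by
  induction y using Finsupp.induction_linear with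
  | zero => simp
  | add x y hx hy =>
    simp only [map_add, hx, hy, mul_add, Finset.sum_add_distrib]
  | single v c =>
    by_cases hv : v.length = 2 * (w₁.length + 1 + w₂.length)
    · obtain ⟨v₁, x, y, v₂, rfl, h₁⟩ :
          ∃ v₁ x y v₂, v = v₁ ++ x :: y :: v₂ ∧ v₁.length = 2 * w₁.length := by
        have hd : (v.drop (2 * w₁.length)).length = 2 + 2 * w₂.length := by
          rw [List.length_drop]; omega
        match h : v.drop (2 * w₁.length), hd with
        | [], hd => simp at hd; omega
        | [_], hd => simp at hd; omega
        | x :: y :: v₂, hd =>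
          exact ⟨v.take (2 * w₁.length), x, y, v₂, by rw [← h]; simp,
            by rw [List.length_take]; omega⟩
      have hc : ∀ (x y : Spin) (d : Kq),
          boxCoeff (w₁ ++ a :: b :: w₂) (cupAt (2 * w₁.length + 1)
            (Finsupp.single (v₁ ++ [x, y] ++ v₂) d)) =
          d * (boxWordCoeff [x, .up, .down, y] [a, b] -
            q⁻¹ * boxWordCoeff [x, .down, .up, y] [a, b]) *
            (boxWordCoeff v₁ w₁ * boxWordCoeff v₂ w₂) := by
        intro x y d
        have hm : ∀ b' c' : Spin,
            boxWordCoeff ((v₁ ++ [x]) ++ b' :: c' :: ([y] ++ v₂)) (w₁ ++ a :: b :: w₂) =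
            boxWordCoeff [x, b', c', y] [a, b] * (boxWordCoeff v₁ w₁ * boxWordCoeff v₂ w₂) := by
          intro b' c'
          rw [← boxWordCoeff_mid v₁ [x, b', c', y] v₂ w₁ [a, b] w₂ h₁ rfl]
          simp
        have hs : v₁ ++ [x, y] ++ v₂ = (v₁ ++ [x]) ++ ([y] ++ v₂) := by simp
        rw [hs, cupAt_single_append (by simp [h₁]), map_sub, boxCoeff_single, boxCoeff_single,
          hm, hm]
        ring
      have hr : ∀ t, boxCoeff (w₁ ++ t :: w₂) (Finsupp.single (v₁ ++ x :: y :: v₂) c) =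
          c * (pi2 x y t * (boxWordCoeff v₁ w₁ * boxWordCoeff v₂ w₂)) := by
        intro t
        rw [boxCoeff_single]
        have := boxWordCoeff_mid v₁ [x, y] v₂ w₁ [t] w₂ h₁ rfl
        simp only [List.cons_append, List.nil_append] at this
        rw [this]
        simp [boxWordCoeff]
      rw [jwAt_single_append h₁]
      simp only [hr, sum_wt]
      have hq := q_ne_zero
      have hq2 := qInt_two_ne_zero
      generalize boxWordCoeff v₁ w₁ * boxWordCoeff v₂ w₂ = B at hc
      cases x <;> cases y <;>
        simp only [jonesWenzl, sandwich, Finsupp.mapDomain_add, Finsupp.mapDomain_smul,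
          Finsupp.mapDomain_single, map_add, map_smul, hc, smul_eq_mul, qInt_two] <;>
        cases a <;> cases b <;> simp [boxWordCoeff, vertexQ, pi2, vUp] <;> field_simp <;> ring
    -- A word whose length does not fit contributes `0` to both sides.
    · rw [boxCoeff_cupAt_jwAt_eq_zero]
      · symm
        refine Finset.sum_eq_zero fun t _ => ?_
        rw [boxCoeff_single, boxWordCoeff_eq_zero]
        · simp
        · simp only [List.length_append, List.length_cons]; omega
      · simp only [List.length_append, List.length_cons]; omega

/-- At the first trivalent vertex no projector is needed: the boxes at the other end of the two
nested arcs already project onto `V₂`. -/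
theorem boxCoeff_tripod (w₁ w₂ : List Wt) (a b d : Wt) (y : V1Tensor) :
    boxCoeff (w₁ ++ a :: b :: d :: w₂)
        (cupAt (2 * w₁.length + 3) (cupAt (2 * w₁.length + 1) (cupAt (2 * w₁.length) y))) =
      (∑ t, strutQ a t * vertexQ b t d) * boxCoeff (w₁ ++ w₂) y := by
  induction y using Finsupp.induction_linear with
  | zero => simp
  | add x y hx hy => simp only [map_add, hx, hy, mul_add]
  | single v c =>
    by_cases hv : v.length = 2 * (w₁ ++ w₂).length
    · obtain ⟨v₁, v₂, rfl, h₁⟩ : ∃ v₁ v₂, v = v₁ ++ v₂ ∧ v₁.length = 2 * w₁.length := by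
        refine ⟨v.take (2 * w₁.length), v.drop (2 * w₁.length), by simp, ?_⟩
        rw [List.length_take, hv, List.length_append]; omega
      have hs : ∀ (x : Spin) (u : List Spin), v₁ ++ x :: u = (v₁ ++ [x]) ++ u := by simp
      have hs' : ∀ (x y z : Spin) (u : List Spin),
          (v₁ ++ [x]) ++ y :: z :: u = (v₁ ++ [x, y, z]) ++ u := by simp
      have hl : ∀ x : Spin, (v₁ ++ [x]).length = 2 * w₁.length + 1 := by simp [h₁]
      have hl' : ∀ x y z : Spin, (v₁ ++ [x, y, z]).length = 2 * w₁.length + 3 := by simp [h₁]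
      rw [cupAt_single_append h₁, map_sub, hs .up, hs .down, cupAt_single_append (hl _),
        cupAt_single_append (hl _), map_sub, map_sub, map_sub, hs', hs', hs', hs']
      simp only [map_sub, fun x y z => cupAt_single_append (hl' x y z)]
      simp only [boxCoeff_single, List.append_assoc]
      have hm : ∀ x₁ x₂ x₃ x₄ x₅ x₆ : Spin,
          boxWordCoeff (v₁ ++ ([x₁, x₂, x₃] ++ x₄ :: x₅ :: x₆ :: v₂)) (w₁ ++ a :: b :: d :: w₂) =
          boxWordCoeff [x₁, x₂, x₃, x₄, x₅, x₆] [a, b, d] *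
            (boxWordCoeff v₁ w₁ * boxWordCoeff v₂ w₂) :=
        fun x₁ x₂ x₃ x₄ x₅ x₆ =>
          boxWordCoeff_mid v₁ [x₁, x₂, x₃, x₄, x₅, x₆] v₂ w₁ [a, b, d] w₂ h₁ rfl
      simp only [hm]
      rw [boxWordCoeff_append h₁, sum_wt]
      generalize boxWordCoeff v₁ w₁ * boxWordCoeff v₂ w₂ = B
      have hq := q_ne_zero
      have hq2 := q_sq_add_one_ne_zero
      cases a <;> cases b <;> cases d <;> simp [boxWordCoeff, strutQ, vertexQ, pi2, vUp] <;>
        field_simp <;> ring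
    -- A word whose length does not fit contributes `0` to both sides.
    · rw [boxCoeff_single, boxWordCoeff_eq_zero hv, cupAt_single, map_sub, map_sub,
        cupAt_single, cupAt_single]
      simp only [map_sub]
      rw [boxCoeff_cupAt_eq_zero, boxCoeff_cupAt_eq_zero, boxCoeff_cupAt_eq_zero,
        boxCoeff_cupAt_eq_zero]
      · simp
      all_goals
        simp only [List.length_append, List.length_cons, List.length_take, List.length_drop] at hv ⊢
        omega

/-- The diagram of a linear tree multiplies coefficients by the value of a chain. -/
theorem boxCoeff_linearTreeDiagram (k : ℕ) (w₁ w w₂ : List Wt) (hw : w.length = k + 2)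
    (y : V1Tensor) :
    boxCoeff (w₁ ++ (w ++ w₂)) (linearTreeDiagram (2 * w₁.length) (k + 2) y) =
      chain strutQ vertexQ w * boxCoeff (w₁ ++ w₂) y := by
  induction k generalizing w w₂ with
  | zero =>
    match w, hw with
    | [a, b], _ =>
      rw [chain_pair]
      exact boxCoeff_strut w₁ w₂ a b y
  | succ k ih =>
    obtain ⟨w', x, b, rfl⟩ : ∃ w' x b, w = w' ++ [x, b] := by
      obtain ⟨w', b, rfl⟩ := List.eq_nil_or_concat w |>.resolve_left (by rintro rfl; simp at hw)
      obtain ⟨w'', x, rfl⟩ := List.eq_nil_or_concat w' |>.resolve_left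
        (by rintro rfl; simp at hw)
      exact ⟨w'', x, b, by simp⟩
    obtain ⟨a, m, rfl⟩ := List.exists_cons_of_ne_nil (l := w') (by rintro rfl; simp at hw)
    have hm : m.length = k := by simpa using hw
    rw [List.cons_append, chain_snoc]
    match k, m, hm with
    | 0, [], _ =>
      simp only [List.nil_append, chain_pair]
      exact boxCoeff_tripod w₁ w₂ a x b y
    | k + 1, m, hm =>
      have hl : 2 * (w₁ ++ a :: m).length = 2 * w₁.length + 2 * k + 4 := by
        simp [hm]; omega
      have key := boxCoeff_vertex (w₁ ++ a :: m) w₂ x b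
        (linearTreeDiagram (2 * w₁.length) (k + 3) y)
      rw [hl] at key
      have h1 : w₁ ++ (a :: (m ++ [x, b]) ++ w₂) = (w₁ ++ a :: m) ++ x :: b :: w₂ := by simp
      rw [h1]
      refine key.trans ?_
      rw [Finset.sum_mul]
      refine Finset.sum_congr rfl fun t _ => ?_
      have h2 := ih (a :: (m ++ [t])) w₂ (by simp [hm])
      have h3 : (w₁ ++ a :: m) ++ t :: w₂ = w₁ ++ (a :: (m ++ [t]) ++ w₂) := by simp
      rw [h3, h2]
      ring

theorem coord_piPow {n : ℕ} (y : V1Tensor) (s : Fin n → Wt) :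
    coord (piPow n y) s = boxCoeff (List.ofFn s) y := by
  have hz : coord (0 : V2Pow n) s = 0 := by simp [coord]
  have hword : ∀ (n : ℕ) (v : List Spin) (h : v.length = 2 * n) (s : Fin n → Wt),
      (∏ i : Fin n, pi2 (v[2 * i.1]'(by omega)) (v[2 * i.1 + 1]'(by omega)) (s i)) =
        boxWordCoeff v (List.ofFn s) := by
    intro n
    induction n with
    | zero =>
      intro v h s
      obtain rfl : v = [] := by simpa using h
      simp [boxWordCoeff]
    | succ n ih =>
      intro v h s
      match v, h with
      | [], h => simp at h
      | [a], h => simp at h; omega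
      | a :: b :: v, h =>
        rw [Fin.prod_univ_succ, List.ofFn_succ, boxWordCoeff,
          ← ih v (by simp at h; omega) (fun i => s i.succ)]
        congr 1
  induction y using Finsupp.induction_linear with
  | zero => simp [hz]
  | add x y hx hy => rw [map_add, map_add, coord_add, hx, hy]
  | single v c =>
    rw [boxCoeff_single, piPow, Finsupp.linearCombination_single, coord_smul]
    split_ifs with h
    · rw [coord_tprod, hword n v h s]
    · rw [hz, boxWordCoeff_eq_zero]
      simpa using h

/-! ### The action of the generators on coefficients -/

/-- The action, on coefficient functions of words, of a generator whose iterated comultiplication is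
`∑ᵢ L ⊗ ⋯ ⊗ L ⊗ A ⊗ R ⊗ ⋯ ⊗ R`, with `L` and `R` diagonal (with eigenvalues `lam` and `mu`);
`A t a` is the coefficient of `v^a` in the image of `v^t`. -/
noncomputable def wordAct (A : Matrix Wt Wt Kq) (lam mu : Wt → Kq) : (List Wt → Kq) → List Wt → Kq
  | _, [] => 0
  | F, a :: w => (w.map mu).prod * ∑ t, A t a * F (t :: w) +
      lam a * wordAct A lam mu (fun u => F (a :: u)) w

section

variable {A : Matrix Wt Wt Kq} {lam mu : Wt → Kq}

theorem wordAct_congr {F G : List Wt → Kq} (w : List Wt)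
    (h : ∀ u, u.length = w.length → F u = G u) :
    wordAct A lam mu F w = wordAct A lam mu G w := by
  induction w generalizing F G with
  | nil => rfl
  | cons a w ih =>
    simp only [wordAct]
    rw [ih (fun u hu => h (a :: u) (by simp [hu]))]
    simp only [fun t => h (t :: w) rfl]

theorem wordAct_mul (c : Kq) (F : List Wt → Kq) (w : List Wt) :
    wordAct A lam mu (fun u => c * F u) w = c * wordAct A lam mu F w := by
  induction w generalizing F with
  | nil => simp [wordAct]
  | cons a w ih =>
    simp only [wordAct]
    rw [ih (fun u => F (a :: u)), mul_add, Finset.mul_sum, Finset.mul_sum, Finset.mul_sum]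
    congr 1
    · exact Finset.sum_congr rfl fun t _ => by ring
    · ring

theorem wordAct_sum {ι : Type*} (S : Finset ι) (F : ι → List Wt → Kq) (w : List Wt) :
    wordAct A lam mu (fun u => ∑ i ∈ S, F i u) w = ∑ i ∈ S, wordAct A lam mu (F i) w := by
  induction w generalizing F with
  | nil => simp [wordAct]
  | cons a w ih =>
    simp only [wordAct]
    rw [ih (fun i u => F i (a :: u)), Finset.sum_add_distrib, Finset.mul_sum, ← Finset.mul_sum]
    simp only [Finset.mul_sum]
    rw [Finset.sum_comm]

/-- The comultiplication rule. -/
theorem wordAct_append (F : List Wt → Kq) (u v : List Wt) :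
    wordAct A lam mu F (u ++ v) =
      (v.map mu).prod * wordAct A lam mu (fun u' => F (u' ++ v)) u +
        (u.map lam).prod * wordAct A lam mu (fun v' => F (u ++ v')) v := by
  induction u generalizing F with
  | nil => simp [wordAct]
  | cons a u ih =>
    simp only [List.cons_append, wordAct, ih, List.map_append, List.prod_append, List.map_cons,
      List.prod_cons]
    ring

theorem wordAct_pair (F : List Wt → Kq) (a b : Wt) :
    wordAct A lam mu F [a, b] =
      mu b * ∑ t, A t a * F [t, b] + lam a * ∑ t, A t b * F [a, t] := by
  simp [wordAct]

/-- Every word with at least three letters ends in a letter, a leg and a last letter. -/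
theorem exists_snoc_pair {α : Type*} {k : ℕ} {w : List α} (hw : w.length = k + 3) :
    ∃ a m x b, w = a :: (m ++ [x, b]) := by
  obtain ⟨a, m, b, rfl⟩ := exists_ends (l := w) (by omega)
  obtain ⟨m, x, rfl⟩ := List.eq_nil_or_concat m |>.resolve_left (by rintro rfl; simp at hw)
  exact ⟨a, m, x, b, by simp⟩

/-- A strut of weight zero and a vertex that preserves the weight give trees of weight zero. -/
theorem prod_mul_chain {S : Matrix Wt Wt Kq} {M : Wt → Matrix Wt Wt Kq}
    (hS : ∀ a b, mu a * mu b * S a b = S a b)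
    (hM : ∀ t a b, mu a * mu b * M a t b = mu t * M a t b) {k : ℕ} (w : List Wt)
    (hw : w.length = k + 2) : (w.map mu).prod * chain S M w = chain S M w := by
  induction k generalizing w with
  | zero =>
    match w, hw with
    | [a, b], _ => simpa [chain_pair] using hS a b
  | succ k ih =>
    obtain ⟨a, m, x, b, rfl⟩ := exists_snoc_pair hw
    rw [chain_snoc, Finset.mul_sum]
    refine Finset.sum_congr rfl fun t _ => ?_
    have h := ih (a :: (m ++ [t])) (by simpa using hw)
    simp only [List.map_cons, List.map_append, List.map_nil, List.prod_cons, List.prod_append,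
      List.prod_nil, mul_one] at h ⊢
    linear_combination M x t b * h + mu a * (m.map mu).prod * chain S M (a :: (m ++ [t])) * hM t x b

/-- A strut and a vertex that are equivariant for a generator give invariant linear trees. -/
theorem wordAct_chain {S : Matrix Wt Wt Kq} {M : Wt → Matrix Wt Wt Kq}
    (hS : ∀ a b, mu b * ∑ t, A t a * S t b + lam a * ∑ t, A t b * S a t = 0)
    (hM : ∀ t a b, mu b * ∑ r, A r a * M r t b + lam a * ∑ r, A r b * M a t r =
      ∑ r, A t r * M a r b)
    (hmu : ∀ t a b, mu a * mu b * M a t b = mu t * M a t b) {k : ℕ} (w : List Wt)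
    (hw : w.length = k + 2) : wordAct A lam mu (chain S M) w = 0 := by
  induction k generalizing w with
  | zero =>
    match w, hw with
    | [a, b], _ =>
      rw [wordAct_pair]
      simpa only [chain_pair] using hS a b
  | succ k ih =>
    obtain ⟨a, m, x, b, rfl⟩ := exists_snoc_pair hw
    have hsnoc : ∀ (u : List Wt) (x b : Wt), u.length = (a :: m).length →
        chain S M (u ++ [x, b]) = ∑ t, M x t b * chain S M (u ++ [t]) := by
      intro u x b hu
      obtain ⟨a', m', rfl⟩ := List.exists_cons_of_ne_nil (l := u) (by rintro rfl; simp at hu)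
      rw [List.cons_append, chain_snoc]
      exact Finset.sum_congr rfl fun t _ => mul_comm _ _
    -- Invariance of the tree with the last vertex removed, whose last leaf carries `r`.
    have hih : ∀ r, M x r b * (mu r * wordAct A lam mu (fun u => chain S M (u ++ [r])) (a :: m) +
        ((a :: m).map lam).prod * ∑ t, A t r * chain S M ((a :: m) ++ [t])) = 0 := by
      intro r
      have h := ih ((a :: m) ++ [r]) (by simpa using hw)
      rw [wordAct_append] at h
      simp only [wordAct, List.map_cons, List.map_nil, List.prod_cons, List.prod_nil, mul_one,
        one_mul, mul_zero, add_zero] at h ⊢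
      rw [h, mul_zero]
    rw [← List.cons_append, wordAct_append, wordAct_pair,
      wordAct_congr (a :: m) (fun u hu => hsnoc u x b hu), wordAct_sum]
    simp only [hsnoc _ _ _ rfl, wordAct_mul]
    -- Equivariance moves the action from the two outputs of the last vertex to its input.
    have h2 : mu b * ∑ t, A t x * ∑ s, M t s b * chain S M (a :: m ++ [s]) +
        lam x * ∑ t, A t b * ∑ s, M x s t * chain S M (a :: m ++ [s]) =
        ∑ r, M x r b * ∑ s, A s r * chain S M (a :: m ++ [s]) := by
      have h3 : ∀ s, chain S M (a :: m ++ [s]) * (mu b * ∑ r, A r x * M r s b +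
          lam x * ∑ r, A r b * M x s r) = chain S M (a :: m ++ [s]) * ∑ r, A s r * M x r b :=
        fun s => by rw [hM]
      have h4 := Finset.sum_congr (rfl : (Finset.univ : Finset Wt) = Finset.univ)
        (fun s _ => h3 s)
      simp only [sum_wt] at h4 ⊢
      linear_combination h4
    rw [h2, Finset.mul_sum, Finset.mul_sum, ← Finset.sum_add_distrib]
    refine Finset.sum_eq_zero fun r _ => ?_
    have h5 := hih r
    simp only [List.map_cons, List.map_nil, List.prod_cons, List.prod_nil, mul_one] at h5 ⊢
    linear_combination h5 + wordAct A lam mu (fun u => chain S M (u ++ [r])) (a :: m) * hmu r x b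

/-- Inserting an invariant tensor of weight zero into an invariant tensor gives an invariant
tensor. -/
theorem wordAct_insert {c F G : List Wt → Kq} {k : ℕ} {w₁ w w₂ : List Wt} (hk : w.length = k)
    (hc : wordAct A lam mu c w = 0)
    (hlam : (w.map lam).prod * c w = c w) (hmu : (w.map mu).prod * c w = c w)
    (hG : ∀ u₁ u u₂ : List Wt, u₁.length = w₁.length → u.length = k →
      G (u₁ ++ (u ++ u₂)) = c u * F (u₁ ++ u₂))
    (hF : wordAct A lam mu F (w₁ ++ w₂) = 0) : wordAct A lam mu G (w₁ ++ (w ++ w₂)) = 0 := by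
  rw [wordAct_append, wordAct_append]
  rw [wordAct_congr (G := fun u => c w * F (u ++ w₂)) w₁ (fun u hu => hG u w w₂ hu hk),
    wordAct_congr (G := fun u => F (w₁ ++ w₂) * c u) w
      (fun u hu => (hG w₁ u w₂ rfl (hu.trans hk)).trans (mul_comm _ _)),
    wordAct_congr (G := fun u => c w * F (w₁ ++ u)) w₂ (fun u _ => hG w₁ w u rfl hk),
    wordAct_mul, wordAct_mul, wordAct_mul, hc]
  rw [wordAct_append] at hF
  rw [List.map_append, List.prod_append]
  linear_combination (c w) * hF +
    ((w₂.map mu).prod * wordAct A lam mu (fun u => F (u ++ w₂)) w₁) * hmu +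
    ((w₁.map lam).prod * wordAct A lam mu (fun u => F (w₁ ++ u)) w₂) * hlam

end

/-! ### Equivariance of the strut and the vertex -/

/-- The matrix of `E` on `V₂`. -/
noncomputable def matE : Matrix Wt Wt Kq
  | .zero, .two => 1
  | .negTwo, .zero => q + q⁻¹
  | _, _ => 0

/-- The matrix of `F` on `V₂`. -/
noncomputable def matF : Matrix Wt Wt Kq
  | .two, .zero => q + q⁻¹
  | .zero, .negTwo => 1
  | _, _ => 0

theorem actE_vUp (s t : Wt) : actE (vUp s) t = matE s t := by
  rw [actE, lift_vUp]
  cases s <;> cases t <;> simp [vLow, vUp, qInt_one, qInt_two, qInt_two_ne_zero, matE]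

theorem actF_vUp (s t : Wt) : actF (vUp s) t = matF s t := by
  rw [actF, lift_vUp]
  cases s <;> cases t <;> simp [vLow, vUp, qInt_one, qInt_two, qInt_two_ne_zero, matF]

/-- The eigenvalues of `K` on `V₂`. -/
noncomputable def eigK (w : Wt) : Kq := q ^ w.val

/-- The eigenvalues of `K⁻¹` on `V₂`. -/
noncomputable def eigKinv (w : Wt) : Kq := q ^ (-w.val)

theorem eigK_mul_strutQ (a b : Wt) : eigK a * eigK b * strutQ a b = strutQ a b := by
  have hq := q_ne_zero
  cases a <;> cases b <;> simp [eigK, Wt.val, strutQ, zpow_neg, zpow_ofNat] <;> field_simp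

theorem eigKinv_mul_strutQ (a b : Wt) : eigKinv a * eigKinv b * strutQ a b = strutQ a b := by
  have hq := q_ne_zero
  cases a <;> cases b <;> simp [eigKinv, Wt.val, strutQ, zpow_neg, zpow_ofNat] <;> field_simp

theorem eigK_mul_vertexQ (t a b : Wt) :
    eigK a * eigK b * vertexQ a t b = eigK t * vertexQ a t b := by
  have hq := q_ne_zero
  have hq2 := q_sq_add_one_ne_zero
  cases t <;> cases a <;> cases b <;> simp [eigK, Wt.val, vertexQ, zpow_neg, zpow_ofNat] <;>
    field_simp

theorem eigKinv_mul_vertexQ (t a b : Wt) :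
    eigKinv a * eigKinv b * vertexQ a t b = eigKinv t * vertexQ a t b := by
  have hq := q_ne_zero
  have hq2 := q_sq_add_one_ne_zero
  cases t <;> cases a <;> cases b <;> simp [eigKinv, Wt.val, vertexQ, zpow_neg, zpow_ofNat] <;>
    field_simp

theorem matE_strutQ (a b : Wt) :
    1 * ∑ t, matE t a * strutQ t b + eigKinv a * ∑ t, matE t b * strutQ a t = 0 := by
  have hq := q_ne_zero
  cases a <;> cases b <;>
    simp [eigKinv, Wt.val, strutQ, matE, sum_wt, zpow_neg, zpow_ofNat] <;> field_simp <;> ring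

theorem matF_strutQ (a b : Wt) :
    eigK b * ∑ t, matF t a * strutQ t b + 1 * ∑ t, matF t b * strutQ a t = 0 := by
  have hq := q_ne_zero
  cases a <;> cases b <;>
    simp [eigK, Wt.val, strutQ, matF, sum_wt, zpow_neg, zpow_ofNat] <;> field_simp <;> ring

theorem matE_vertexQ (t a b : Wt) :
    1 * ∑ r, matE r a * vertexQ r t b + eigKinv a * ∑ r, matE r b * vertexQ a t r =
      ∑ r, matE t r * vertexQ a r b := by
  have hq := q_ne_zero
  have hq2 := q_sq_add_one_ne_zero
  cases t <;> cases a <;> cases b <;>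
    simp [eigKinv, Wt.val, vertexQ, matE, sum_wt, zpow_neg, zpow_ofNat] <;> field_simp <;> ring

theorem matF_vertexQ (t a b : Wt) :
    eigK b * ∑ r, matF r a * vertexQ r t b + 1 * ∑ r, matF r b * vertexQ a t r =
      ∑ r, matF t r * vertexQ a r b := by
  have hq := q_ne_zero
  have hq2 := q_sq_add_one_ne_zero
  cases t <;> cases a <;> cases b <;>
    simp [eigK, Wt.val, vertexQ, matF, sum_wt, zpow_neg, zpow_ofNat] <;> field_simp <;> ring

/-! ### Coordinates of the action on `V₂^{⊗ n}` -/

theorem coord_sum {n : ℕ} {ι : Type*} (S : Finset ι) (g : ι → V2Pow n) (t : Fin n → Wt) :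
    coord (∑ i ∈ S, g i) t = ∑ i ∈ S, coord (g i) t := by
  simp [coord]

/-- The list recursion `wordAct` computes the iterated comultiplication. -/
theorem sum_mul_sum_prod_eq_wordAct {n : ℕ} (A : Matrix Wt Wt Kq) (lam mu : Wt → Kq)
    (B : Fin n → Fin n → Wt → Wt → Kq) (F : List Wt → Kq) (t : Fin n → Wt)
    (hB : ∀ i j a b, B i j a b = if j = i then A a b else
      if j < i then (if b = a then lam a else 0) else (if b = a then mu a else 0)) :
    ∑ s : Fin n → Wt, F (List.ofFn s) * ∑ i, ∏ j, B i j (s j) (t j) =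
      wordAct A lam mu F (List.ofFn t) := by
  induction n generalizing F with
  | zero => simp [wordAct]
  | succ n ih =>
    rw [← (Fin.consEquiv fun _ => Wt).sum_comp, Fintype.sum_prod_type, List.ofFn_succ, wordAct,
      ← ih (fun i j => B i.succ j.succ) _ (fun j => t j.succ) (fun i j a b => by simp [hB])]
    -- In the term `i = 0` the other factors are diagonal, so that only `s = tail t` contributes.
    have hfirst : ∀ (a : Wt) (s : Fin n → Wt),
        ∏ j, B 0 j ((Fin.cons a s : Fin (n + 1) → Wt) j) (t j) =
          A a (t 0) * if (fun j => t (Fin.succ j)) = s then ∏ j, mu (s j) else 0 := by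
      intro a s
      rw [Fin.prod_univ_succ]
      simp only [hB, Fin.cons_zero, Fin.cons_succ, Fin.succ_ne_zero, Fin.not_lt_zero, if_true,
        if_false]
      split_ifs with h
      · simp [← h]
      · obtain ⟨j, hj⟩ := Function.ne_iff.1 h
        rw [Finset.prod_eq_zero (Finset.mem_univ j) (if_neg hj)]
    -- In the other terms the factor number `0` is diagonal.
    have hrest : ∀ (a : Wt) (s : Fin n → Wt) (i : Fin n),
        ∏ j, B i.succ j ((Fin.cons a s : Fin (n + 1) → Wt) j) (t j) =
          (if t 0 = a then lam a else 0) * ∏ j, B i.succ j.succ (s j) (t j.succ) := by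
      intro a s i
      rw [Fin.prod_univ_succ]
      congr 1
      simp only [hB, Fin.cons_zero, Fin.succ_pos, (Fin.succ_ne_zero i).symm, if_true, if_false]
    simp only [Fin.consEquiv_apply, Fin.sum_univ_succ, hfirst, hrest, List.ofFn_succ, Fin.cons_zero,
      Fin.cons_succ, mul_add, Finset.sum_add_distrib]
    congr 1
    · rw [Finset.mul_sum]
      refine Finset.sum_congr rfl fun a _ => ?_
      rw [Finset.sum_eq_single fun j => t (Fin.succ j)]
      · rw [if_pos rfl, List.map_ofFn, List.prod_ofFn]
        simp only [Function.comp_apply]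
        ring
      · intro s _ hs
        rw [if_neg hs.symm, mul_zero, mul_zero]
      · simp
    · rw [Finset.sum_eq_single (t 0)]
      · simp only [if_true, ← Finset.mul_sum]
        rw [Finset.mul_sum]
        exact Finset.sum_congr rfl fun s _ => by ring
      · intro a _ ha
        refine Finset.sum_eq_zero fun s _ => ?_
        simp [ha.symm]
      · simp

theorem coord_map {n : ℕ} (A : Fin n → V2 →ₗ[Kq] V2) (x : V2Pow n) (t : Fin n → Wt) :
    coord (PiTensorProduct.map A x) t = ∑ s, coord x s * ∏ j, A j (vUp (s j)) (t j) := by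
  conv_lhs => rw [sum_coord x]
  simp only [map_sum, map_smul, PiTensorProduct.map_tprod, coord_sum, coord_smul, coord_tprod]

theorem coord_sum_map {n : ℕ} (A : Fin n → Fin n → V2 →ₗ[Kq] V2) (x : V2Pow n)
    (t : Fin n → Wt) : coord ((∑ i, PiTensorProduct.map (A i)) x) t =
      ∑ s, coord x s * ∑ i, ∏ j, A i j (vUp (s j)) (t j) := by
  simp only [LinearMap.sum_apply, coord_sum, coord_map, Finset.mul_sum]
  rw [Finset.sum_comm]

theorem coord_ext {n : ℕ} {x y : V2Pow n} (h : ∀ s, coord x s = coord y s) : x = y := by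
  rw [sum_coord x, sum_coord y]
  simp only [h]

theorem coord_powE {n : ℕ} {x : V2Pow n} {F : List Wt → Kq}
    (hF : ∀ s, coord x s = F (List.ofFn s)) (t : Fin n → Wt) :
    coord (powE n x) t = wordAct matE eigKinv (fun _ => 1) F (List.ofFn t) := by
  rw [powE, coord_sum_map, ← sum_mul_sum_prod_eq_wordAct _ _ _ _ F t fun i j a b => rfl]
  simp only [hF]
  refine Finset.sum_congr rfl fun s _ => ?_
  congr 1
  refine Finset.sum_congr rfl fun i _ => Finset.prod_congr rfl fun j _ => ?_
  split_ifs with h1 h2 h3 h3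
  · exact actE_vUp _ _
  · rw [actKinv, lift_vUp]; simp [h3, vUp, eigKinv]
  · rw [actKinv, lift_vUp]; simp [h3, vUp]
  · simp [h3, vUp]
  · simp [h3, vUp]

theorem coord_powF {n : ℕ} {x : V2Pow n} {F : List Wt → Kq}
    (hF : ∀ s, coord x s = F (List.ofFn s)) (t : Fin n → Wt) :
    coord (powF n x) t = wordAct matF (fun _ => 1) eigK F (List.ofFn t) := by
  rw [powF, coord_sum_map, ← sum_mul_sum_prod_eq_wordAct _ _ _ _ F t fun i j a b => rfl]
  simp only [hF]
  refine Finset.sum_congr rfl fun s _ => ?_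
  congr 1
  refine Finset.sum_congr rfl fun i _ => Finset.prod_congr rfl fun j _ => ?_
  by_cases h1 : j = i
  · simp [h1, actF_vUp]
  · rcases lt_or_gt_of_ne h1 with h2 | h2
    · simp [h1, h2, h2.not_gt, vUp, Pi.single_apply]
    · rw [if_neg h1, if_pos h2, if_neg h1, if_neg h2.not_gt, actK, lift_vUp]
      by_cases h3 : t j = s j <;> simp [h3, vUp, eigK]

theorem coord_powK {n : ℕ} (x : V2Pow n) (t : Fin n → Wt) :
    coord (powK n x) t = (∏ j, eigK (t j)) * coord x t := by
  rw [powK, coord_map, Finset.sum_eq_single t]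
  · simp only [actK, lift_vUp]
    simp [vUp, eigK, mul_comm]
  · intro s _ hs
    obtain ⟨j, hj⟩ := Function.ne_iff.1 hs
    rw [Finset.prod_eq_zero (Finset.mem_univ j), mul_zero]
    rw [actK, lift_vUp]
    simp [vUp, hj.symm]
  · simp

/-! ### Invariant coefficient functions -/

/-- The coefficients `F w`, over the words `w` of length `N`, are those of an invariant tensor of
`V₂^{⊗ N}`. -/
structure IsInvariantCoeff (N : ℕ) (F : List Wt → Kq) : Prop where
  actE : ∀ w, w.length = N → wordAct matE eigKinv (fun _ => 1) F w = 0
  actF : ∀ w, w.length = N → wordAct matF (fun _ => 1) eigK F w = 0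
  actK : ∀ w, w.length = N → (w.map eigK).prod * F w = F w

/-- For `K` this uses that `x` is fixed coordinatewise, the word basis being one of eigenvectors. -/
theorem mem_invUq_of_isInvariantCoeff {n : ℕ} {x : V2Pow n} {F : List Wt → Kq}
    (hF : ∀ s, coord x s = F (List.ofFn s)) (h : IsInvariantCoeff n F) : x ∈ invUq n := by
  have hz : ∀ s, coord (0 : V2Pow n) s = 0 := fun s => by simp [coord]
  refine ⟨⟨?_, ?_⟩, ?_⟩
  · refine LinearMap.mem_ker.2 (coord_ext fun s => ?_)
    rw [coord_powE hF, h.actE _ (List.length_ofFn), hz]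
  · refine LinearMap.mem_ker.2 (coord_ext fun s => ?_)
    rw [coord_powF hF, h.actF _ (List.length_ofFn), hz]
  · refine LinearMap.mem_ker.2 (sub_eq_zero.2 (coord_ext fun s => ?_))
    rw [coord_powK, LinearMap.id_apply, hF]
    have := h.actK (List.ofFn s) List.length_ofFn
    rwa [List.map_ofFn, List.prod_ofFn] at this

/-- Inserting a linear tree into a tensor, to the right of the first `l` factors, preserves
invariance. -/
theorem IsInvariantCoeff.insert_chain {N l k : ℕ} {F G : List Wt → Kq} (hF : IsInvariantCoeff N F)
    (hl : l ≤ N)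
    (hG : ∀ w₁ w w₂ : List Wt, w₁.length = l → w.length = k + 2 →
      G (w₁ ++ (w ++ w₂)) = chain strutQ vertexQ w * F (w₁ ++ w₂)) :
    IsInvariantCoeff (N + (k + 2)) G := by
  have split : ∀ u : List Wt, u.length = N + (k + 2) → ∃ w₁ w w₂, u = w₁ ++ (w ++ w₂) ∧
      w₁.length = l ∧ w.length = k + 2 ∧ (w₁ ++ w₂).length = N := by
    intro u hu
    refine ⟨u.take l, (u.drop l).take (k + 2), (u.drop l).drop (k + 2), by simp, ?_, ?_, ?_⟩ <;>
      simp only [List.length_append, List.length_take, List.length_drop] <;> omega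
  have hK := fun w (hw : w.length = k + 2) =>
    prod_mul_chain eigK_mul_strutQ eigK_mul_vertexQ w hw
  have hKinv := fun w (hw : w.length = k + 2) =>
    prod_mul_chain eigKinv_mul_strutQ eigKinv_mul_vertexQ w hw
  have hone : ∀ w : List Wt, (w.map fun _ => (1 : Kq)).prod * chain strutQ vertexQ w =
      chain strutQ vertexQ w := by simp
  refine ⟨fun u hu => ?_, fun u hu => ?_, fun u hu => ?_⟩ <;>
    obtain ⟨w₁, w, w₂, rfl, h₁, hw, h₂⟩ := split u hu
  · exact wordAct_insert hw (wordAct_chain matE_strutQ matE_vertexQ (by simp) w hw) (hKinv w hw)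
      (hone w) (fun u₁ u u₂ h h' => hG u₁ u u₂ (h.trans h₁) h') (hF.actE _ h₂)
  · exact wordAct_insert hw (wordAct_chain matF_strutQ matF_vertexQ eigK_mul_vertexQ w hw) (hone w)
      (hK w hw) (fun u₁ u u₂ h h' => hG u₁ u u₂ (h.trans h₁) h') (hF.actF _ h₂)
  · have h3 := hF.actK _ h₂
    have h4 := hK w hw
    rw [hG _ _ _ h₁ hw]
    simp only [List.map_append, List.prod_append] at h3 ⊢
    linear_combination (chain strutQ vertexQ w) * h3 +
      (w₁.map eigK).prod * (w₂.map eigK).prod * F (w₁ ++ w₂) * h4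

/-! ### The diagram of a Riordan tree -/

theorem sort_union_of_lt {α : Type*} [LinearOrder α] (S T : Finset α)
    (h : ∀ a ∈ S, ∀ b ∈ T, a < b) : (S ∪ T).sort = S.sort ++ T.sort := by
  refine List.Perm.eq_of_pairwise (le := (· ≤ ·)) (fun a b _ _ => le_antisymm)
    (Finset.pairwise_sort _ _) ?_ ?_
  · refine List.pairwise_append.2 ⟨Finset.pairwise_sort _ _, Finset.pairwise_sort _ _, ?_⟩
    intro a ha b hb
    exact (h a ((Finset.mem_sort _).1 ha) b ((Finset.mem_sort _).1 hb)).le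
  · rw [← Multiset.coe_eq_coe, ← Multiset.coe_add, Finset.sort_eq, Finset.sort_eq, Finset.sort_eq]
    have hd : Disjoint S T := Finset.disjoint_left.2 fun a ha hb => (h a ha a hb).false
    rw [← Finset.disjUnion_eq_union _ _ hd]
    rfl

namespace RiordanPartition

variable {n : ℕ} (P : RiordanPartition n)

/-- The word formed by the values of `s` on the part of `i`, in increasing order of the labels. -/
def partWord {α : Type*} (s : Fin n → α) (i : Fin n) : List α := ((P.part i).sort).map s

theorem length_partWord {α : Type*} (s : Fin n → α) (i : Fin n) :
    (P.partWord s i).length = (P.part i).card := by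
  simp [partWord]

theorem two_le_card_part (i : Fin n) : 2 ≤ (P.part i).card :=
  P.two_le_card _ (P.part_mem.2 (Finset.mem_univ i))

/-- The labels of the parts whose smallest element is less than `m`: the boxes that are connected
to the part of the diagram drawn before step `m`. -/
def started (m : ℕ) : Finset (Fin n) :=
  Finset.univ.filter fun j => ∃ i ∈ P.part j, i.1 < m

theorem mem_started {m : ℕ} {j : Fin n} : j ∈ P.started m ↔ ∃ i ∈ P.part j, i.1 < m := by
  simp [started]

theorem started_succ_of_not_isFirst {i : Fin n} (h : ¬ P.IsFirst i) :
    P.started (i.1 + 1) = P.started i.1 := by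
  ext j
  simp only [mem_started]
  refine ⟨?_, fun ⟨k, hk, hki⟩ => ⟨k, hk, by omega⟩⟩
  rintro ⟨k, hk, hki⟩
  rcases Nat.lt_succ_iff_lt_or_eq.1 hki with h1 | h1
  · exact ⟨k, hk, h1⟩
  · obtain rfl : k = i := Fin.ext h1
    simp only [IsFirst, not_forall, not_le] at h
    obtain ⟨l, hl, hlt⟩ := h
    exact ⟨l, by rw [← P.part_eq hk]; exact hl, hlt⟩

/-- Nothing is drawn yet between the labels of a part that starts at `i`: noncrossing. -/
theorem lt_of_mem_started {i j k : Fin n} (h : P.IsFirst i) (hj : j ∈ P.started i.1)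
    (hij : i ≤ j) (hk : k ∈ P.part i) : k < j := by
  obtain ⟨a, ha, hai⟩ := P.mem_started.1 hj
  have hne : P.part j ≠ P.part i := by
    intro he
    rw [he] at ha
    exact absurd (h a ha) (not_le.2 hai)
  have hij' : i < j := lt_of_le_of_ne hij (by rintro rfl; exact hne rfl)
  by_contra hlt
  have hjk : j < k := lt_of_le_of_ne (not_lt.1 hlt) (by rintro rfl; exact hne (P.part_eq hk))
  exact P.noncrossing _ (P.part_mem.2 (Finset.mem_univ j)) _ (P.part_mem.2 (Finset.mem_univ i)) hne
    ⟨a, i, j, k, hai, hij', hjk, ha, P.self_mem i, P.self_mem j, hk⟩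

/-- Drawing the part that begins with `i` inserts its labels, consecutively, right after the labels
less than `i`. -/
theorem sort_started {i : Fin n} (h : P.IsFirst i) : ∃ T : Finset (Fin n),
    (P.started i.1).sort = (Finset.Iio i).sort ++ T.sort ∧
    (P.started (i.1 + 1)).sort = (Finset.Iio i).sort ++ ((P.part i).sort ++ T.sort) := by
  have hlow : ∀ j, j < i → j ∈ P.started i.1 := fun j hj =>
    P.mem_started.2 ⟨j, P.self_mem j, hj⟩
  refine ⟨(P.started i.1).filter (i ≤ ·), ?_, ?_⟩
  · rw [← sort_union_of_lt]
    · congr 1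
      ext j
      simp only [Finset.mem_union, Finset.mem_Iio, Finset.mem_filter]
      by_cases hj : j < i
      · simp [hj, hlow j hj]
      · simp [hj, not_lt.1 hj]
    · intro a ha b hb
      exact (Finset.mem_Iio.1 ha).trans_le (Finset.mem_filter.1 hb).2
  · rw [← sort_union_of_lt, ← sort_union_of_lt]
    · congr 1
      ext j
      simp only [Finset.mem_union, Finset.mem_Iio, Finset.mem_filter]
      by_cases hj : j < i
      · simp only [hj, true_or, iff_true]
        obtain ⟨k, hk, hki⟩ := P.mem_started.1 (hlow j hj)
        exact P.mem_started.2 ⟨k, hk, by omega⟩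
      · simp only [hj, false_or, not_lt.1 hj, and_true]
        simp only [mem_started]
        constructor
        · rintro ⟨k, hk, hki⟩
          rcases Nat.lt_succ_iff_lt_or_eq.1 hki with h1 | h1
          · exact Or.inr ⟨k, hk, h1⟩
          · obtain rfl : k = i := Fin.ext h1
            left
            rw [P.part_eq hk]
            exact P.self_mem j
        · rintro (hji | ⟨k, hk, hki⟩)
          · exact ⟨i, by rw [P.part_eq hji]; exact P.self_mem i, by omega⟩
          · exact ⟨k, hk, by omega⟩
    · intro a ha b hb
      have ha := Finset.mem_Iio.1 ha
      rcases Finset.mem_union.1 hb with hb | hb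
      · exact ha.trans_le (h b hb)
      · exact ha.trans_le (Finset.mem_filter.1 hb).2
    · intro a ha b hb
      obtain ⟨h1, h2⟩ := Finset.mem_filter.1 hb
      exact P.lt_of_mem_started h h1 h2 ha

/-- The stages of the construction of the diagram: the coefficients are products, over the parts
drawn so far, of chains, and they are those of an invariant tensor. -/
theorem boxCoeff_foldl {m : ℕ} (hm : m ≤ n) :
    IsInvariantCoeff (P.started m).card (fun w => boxCoeff w (((List.finRange n).take m).foldl
      (fun x i => if P.IsFirst i then linearTreeDiagram (2 * i.1) (P.part i).card x else x)
      (Finsupp.single [] 1))) ∧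
    ∀ s : Fin n → Wt, boxCoeff ((P.started m).sort.map s) (((List.finRange n).take m).foldl
      (fun x i => if P.IsFirst i then linearTreeDiagram (2 * i.1) (P.part i).card x else x)
      (Finsupp.single [] 1)) =
      ∏ i ∈ Finset.univ.filter (fun i => P.IsFirst i ∧ i.1 < m),
        chain strutQ vertexQ (P.partWord s i) := by
  induction m with
  | zero =>
    have h0 : P.started 0 = ∅ := by simp [started]
    rw [h0]
    refine ⟨⟨fun w hw => ?_, fun w hw => ?_, fun w hw => ?_⟩, fun s => ?_⟩
    · obtain rfl : w = [] := by simpa using hw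
      rfl
    · obtain rfl : w = [] := by simpa using hw
      rfl
    · obtain rfl : w = [] := by simpa using hw
      simp
    · simp [boxCoeff_single, boxWordCoeff]
  | succ m ih =>
    obtain ⟨ih1, ih2⟩ := ih (by omega)
    set i : Fin n := ⟨m, hm⟩ with hi
    rw [List.take_succ_eq_append_getElem (by simpa using hm), List.foldl_append, List.foldl_cons,
      List.foldl_nil, List.getElem_finRange]
    change IsInvariantCoeff _ (fun w => boxCoeff w (if P.IsFirst i then _ else _)) ∧
      ∀ s : Fin n → Wt, boxCoeff _ (if P.IsFirst i then _ else _) = _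
    by_cases hf : P.IsFirst i
    · simp only [if_pos hf]
      obtain ⟨T, hT1, hT2⟩ := P.sort_started hf
      change (P.started m).sort = _ at hT1
      change (P.started (m + 1)).sort = _ at hT2
      obtain ⟨k, hk⟩ := Nat.exists_eq_add_of_le' (P.two_le_card_part i)
      have hIio : (Finset.Iio i).sort.length = m := by simp [hi]
      have hins : ∀ (y : V1Tensor) (w₁ w w₂ : List Wt), w₁.length = m → w.length = k + 2 →
          boxCoeff (w₁ ++ (w ++ w₂)) (linearTreeDiagram (2 * i.1) (P.part i).card y) =
          chain strutQ vertexQ w * boxCoeff (w₁ ++ w₂) y := by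
        intro y w₁ w w₂ h₁ hw
        have h := boxCoeff_linearTreeDiagram k w₁ w w₂ hw y
        rw [h₁] at h
        rw [hk]
        exact h
      constructor
      · have hc : (P.started (m + 1)).card = (P.started m).card + (k + 2) := by
          have h1 := congrArg List.length hT1
          have h2 := congrArg List.length hT2
          simp only [List.length_append, Finset.length_sort] at h1 h2
          omega
        have hl : m ≤ (P.started m).card := by
          have h1 := congrArg List.length hT1
          rw [List.length_append, hIio, Finset.length_sort] at h1
          omega
        rw [hc]
        exact ih1.insert_chain hl (hins _)
      · intro s
        have hset : Finset.univ.filter (fun j => P.IsFirst j ∧ j.1 < m + 1) =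
            insert i (Finset.univ.filter fun j => P.IsFirst j ∧ j.1 < m) := by
          ext j
          simp only [Finset.mem_filter, Finset.mem_univ, true_and, Finset.mem_insert]
          constructor
          · rintro ⟨h1, h2⟩
            rcases Nat.lt_succ_iff_lt_or_eq.1 h2 with h3 | h3
            · exact Or.inr ⟨h1, h3⟩
            · exact Or.inl (Fin.ext h3)
          · rintro (rfl | ⟨h1, h2⟩)
            · exact ⟨hf, Nat.lt_succ_self _⟩
            · exact ⟨h1, by omega⟩
        rw [hset, Finset.prod_insert (by simp [hi]), ← ih2 s, hT1, hT2]
        simp only [List.map_append]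
        refine hins _ _ _ _ (by simpa using hIio) ?_
        rw [List.length_map, Finset.length_sort, hk]
    · simp only [if_neg hf]
      rw [show P.started (m + 1) = P.started m from P.started_succ_of_not_isFirst hf]
      refine ⟨ih1, fun s => ?_⟩
      rw [ih2 s]
      congr 1
      ext j
      simp only [Finset.mem_filter, Finset.mem_univ, true_and, and_congr_right_iff]
      intro hj
      refine ⟨fun h => by omega, fun h => ?_⟩
      refine lt_of_le_of_ne (Nat.lt_succ_iff.1 h) fun he => hf ?_
      have : j = i := Fin.ext he
      exact this ▸ hj

theorem started_self : P.started n = Finset.univ :=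
  Finset.eq_univ_iff_forall.2 fun j => P.mem_started.2 ⟨j, P.self_mem j, j.2⟩

theorem sort_univ_map {α : Type*} (s : Fin n → α) :
    (Finset.univ : Finset (Fin n)).sort.map s = List.ofFn s := by
  rw [Fin.sort_univ, List.ofFn_eq_map]

/-- The coordinates of `f(T)`, as products over the parts (indexed by their smallest elements). -/
theorem coord_fElement (s : Fin n → Wt) : coord (fElement P) s =
    ∏ i ∈ Finset.univ.filter P.IsFirst, chain strutQ vertexQ (P.partWord s i) := by
  have h := (P.boxCoeff_foldl le_rfl).2 s
  rw [P.started_self, sort_univ_map, List.take_of_length_le (by simp)] at h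
  rw [fElement, coord_piPow, treeStrands, h]
  congr 1
  ext j
  simp

theorem fElement_mem_invUq : fElement P ∈ invUq n := by
  have h := (P.boxCoeff_foldl le_rfl).1
  rw [P.started_self, List.take_of_length_le (by simp), Finset.card_univ, Fintype.card_fin] at h
  exact mem_invUq_of_isInvariantCoeff (fun s => coord_piPow _ s) h

end RiordanPartition

/-! ### Summation over part of the variables -/

/-- The sum of `G` over all values of the variables in the list `L`, the others being those
of `t`. -/
def sumOver {ι Γ : Type*} [Fintype Γ] [DecidableEq ι] :
    List ι → ((ι → Γ) → ℂ) → (ι → Γ) → ℂ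
  | [], G, t => G t
  | i :: L, G, t => ∑ a, sumOver L G (Function.update t i a)

section

variable {ι Γ : Type*} [Fintype Γ] [DecidableEq ι]

theorem sumOver_append (L₁ L₂ : List ι) (G : (ι → Γ) → ℂ) (t : ι → Γ) :
    sumOver (L₁ ++ L₂) G t = sumOver L₁ (sumOver L₂ G) t := by
  induction L₁ generalizing t with
  | nil => rfl
  | cons i L₁ ih => simp only [List.cons_append, sumOver, ih]

theorem sumOver_mul_left {L : List ι} {F : (ι → Γ) → ℂ}
    (hF : ∀ t, ∀ i ∈ L, ∀ a, F (Function.update t i a) = F t) (G : (ι → Γ) → ℂ) (t : ι → Γ) :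
    sumOver L (fun u => F u * G u) t = F t * sumOver L G t := by
  induction L generalizing t with
  | nil => rfl
  | cons i L ih =>
    simp only [sumOver, Finset.mul_sum]
    refine Finset.sum_congr rfl fun a _ => ?_
    rw [ih (fun t j hj a => hF t j (List.mem_cons_of_mem _ hj) a), hF t i List.mem_cons_self]

open scoped Classical in
theorem sumOver_eq_sum [Fintype ι] {L : List ι} (hL : L.Nodup) (G : (ι → Γ) → ℂ) (t : ι → Γ) :
    sumOver L G t = ∑ v : ι → Γ, if ∀ k ∉ L, v k = t k then G v else 0 := by
  induction L generalizing t with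
  | nil =>
    simp only [sumOver, List.not_mem_nil, not_false_eq_true, true_implies]
    rw [Finset.sum_eq_single t]
    · simp
    · intro v _ hv
      rw [if_neg fun h => hv (funext h)]
    · simp
  | cons i L ih =>
    obtain ⟨hi, hL⟩ := List.nodup_cons.1 hL
    simp only [sumOver, ih hL]
    rw [Finset.sum_comm]
    refine Finset.sum_congr rfl fun v _ => ?_
    rw [Finset.sum_eq_single (v i)]
    · congr 1
      refine propext ⟨fun h k hk => ?_, fun h k hk => ?_⟩
      · have h1 : k ≠ i := fun he => hk (he ▸ List.mem_cons_self)
        rw [h k (fun hk' => hk (List.mem_cons_of_mem _ hk')), Function.update_of_ne h1]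
      · by_cases h1 : k = i
        · subst h1; simp
        · rw [Function.update_of_ne h1]
          exact h k (by simp [h1, hk])
    · intro a _ ha
      rw [if_neg]
      intro h
      have := h i hi
      rw [Function.update_self] at this
      exact ha this.symm
    · simp

/-- A sum over functions on a subtype, as a sum over the variables listed in `L`; the values `t` of
the other variables are irrelevant. -/
theorem sum_subtype_eq_sumOver [Fintype ι] {p : ι → Prop} [DecidablePred p] {L : List ι}
    (hL : L.Nodup) (hp : ∀ i, i ∈ L ↔ p i) (H : ({i // p i} → Γ) → ℂ) (t : ι → Γ) :
    ∑ τ, H τ = sumOver L (fun v => H fun i => v i.1) t := by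
  classical
  rw [sumOver_eq_sum hL, ← Finset.sum_filter]
  refine Finset.sum_bij' (fun τ _ i => if h : p i then τ ⟨i, h⟩ else t i)
    (fun v _ i => v i.1) ?_ ?_ ?_ ?_ ?_
  · intro τ _
    simp only [Finset.mem_filter, Finset.mem_univ, true_and]
    intro k hk
    rw [dif_neg (by rwa [← hp])]
  · simp
  · intro τ _
    funext i
    simp [i.2]
  · intro v hv
    funext i
    simp only [Finset.mem_filter, Finset.mem_univ, true_and] at hv
    by_cases h : p i
    · simp [h]
    · simp [h, hv i (by rwa [hp])]
  · intro τ _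
    congr 1
    funext i
    simp [i.2]

end

theorem sum_fin_three {α : Type*} [Fintype α] (f : α → α → α → ℂ) :
    ∑ v : Fin 3 → α, f (v 0) (v 1) (v 2) = ∑ a, ∑ b, ∑ c, f a b c := by
  rw [← (Fin.consEquiv fun _ => α).sum_comp, Fintype.sum_prod_type]
  refine Finset.sum_congr rfl fun a _ => ?_
  rw [← (Fin.consEquiv fun _ => α).sum_comp, Fintype.sum_prod_type]
  refine Finset.sum_congr rfl fun b _ => ?_
  rw [← (Fin.consEquiv fun _ => α).sum_comp, Fintype.sum_prod_type]
  refine Finset.sum_congr rfl fun c _ => ?_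
  simp [Fin.consEquiv]
  rfl

/-! ### The weight of a Riordan tree -/

theorem sum_gen {M : Type*} [AddCommMonoid M] (g : Gen → M) :
    ∑ x, g x = g .h + (g .e + g .f) := by
  change ∑ x ∈ ({.h, .e, .f} : Finset Gen), g x = _
  rw [Finset.sum_insert (by decide), Finset.sum_insert (by decide), Finset.sum_singleton]

/-- The matrix of a strut. -/
noncomputable def strutW : Matrix Gen Gen ℂ := Matrix.of casimir

/-- The matrix of a trivalent vertex whose leg carries `x`, contracted with the incoming spine
edge. -/
noncomputable def vertexW (x : Gen) : Matrix Gen Gen ℂ :=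
  Matrix.of fun y s => ∑ p, kappa y p * bracketTensor p x s

/-- The Casimir tensor is inverse to `κ`. -/
theorem strutW_mul_vertexW (a x s : Gen) : (strutW * vertexW x) a s = bracketTensor a x s := by
  rw [Matrix.mul_apply]
  cases a <;> cases x <;> cases s <;>
    simp [sum_gen, strutW, vertexW, casimir, kappa, bracketTensor]

namespace RiordanPartition

variable {n : ℕ} (P : RiordanPartition n)

/-- The labelling of the half-edges of the tree by the states `τ` of the trivalent vertices and the
labels `g` of the leaves.  For convenience there are states at all `i : Fin n`, but only
those at the trivalent vertices are used. -/
def halfLabel (g : Fin n → Gen) (τ : Fin n → Fin 3 → Gen) : (P.Inner × Fin 3) ⊕ Fin n → Gen :=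
  Sum.elim (fun p => τ p.1.1 p.2) g

/-- The factor of a trivalent vertex together with its leg. -/
noncomputable def vertexFactor (g : Fin n → Gen) (i : Fin n) (v : Fin 3 → Gen) : ℂ :=
  bracketTensor (v 0) (v 1) (v 2) * if v 1 = g i then 1 else 0

/-- The factor of the spine edge that leaves `i` to the right. -/
noncomputable def spineFactor (g : Fin n → Gen) (i : Fin n) (h : ¬ P.IsLast i)
    (τ : Fin n → Fin 3 → Gen) : ℂ :=
  P.tree.edgeWeight (P.rightEnd i h) (P.leftEnd (P.next i h) (P.next_not_first i h))
    (P.halfLabel g τ (P.rightEnd i h))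
    (P.halfLabel g τ (P.leftEnd (P.next i h) (P.next_not_first i h)))

/-- All the factors attached to the label `i`. -/
noncomputable def labelFactor (g : Fin n → Gen) (i : Fin n) (τ : Fin n → Fin 3 → Gen) : ℂ :=
  (if ¬ P.IsFirst i ∧ ¬ P.IsLast i then vertexFactor g i (τ i) else 1) *
    if h : ¬ P.IsLast i then P.spineFactor g i h τ else 1

variable {P} in
theorem labelFactor_last {g : Fin n → Gen} {i : Fin n} (h : P.IsLast i)
    (τ : Fin n → Fin 3 → Gen) : P.labelFactor g i τ = 1 := by
  simp [labelFactor, h]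

variable {P} in
theorem labelFactor_first_last {g : Fin n → Gen} {i : Fin n} (hf : P.IsFirst i)
    (h : ¬ P.IsLast i) (hn : P.IsLast (P.next i h)) (τ : Fin n → Fin 3 → Gen) :
    P.labelFactor g i τ = strutW (g i) (g (P.next i h)) := by
  simp [labelFactor, h, hf, spineFactor, rightEnd, leftEnd, hn, halfLabel,
    JacobiDiagram.edgeWeight, strutW]

variable {P} in
theorem labelFactor_first_inner {g : Fin n → Gen} {i : Fin n} (hf : P.IsFirst i)
    (h : ¬ P.IsLast i) (hn : ¬ P.IsLast (P.next i h)) (τ : Fin n → Fin 3 → Gen) :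
    P.labelFactor g i τ = if g i = τ (P.next i h) 0 then 1 else 0 := by
  simp [labelFactor, h, hf, spineFactor, rightEnd, leftEnd, hn, halfLabel,
    JacobiDiagram.edgeWeight]

variable {P} in
theorem labelFactor_inner_last {g : Fin n → Gen} {i : Fin n} (hf : ¬ P.IsFirst i)
    (h : ¬ P.IsLast i) (hn : P.IsLast (P.next i h)) (τ : Fin n → Fin 3 → Gen) :
    P.labelFactor g i τ =
      vertexFactor g i (τ i) * if τ i 2 = g (P.next i h) then 1 else 0 := by
  simp [labelFactor, h, hf, spineFactor, rightEnd, leftEnd, hn, halfLabel,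
    JacobiDiagram.edgeWeight]

variable {P} in
theorem labelFactor_inner_inner {g : Fin n → Gen} {i : Fin n} (hf : ¬ P.IsFirst i)
    (h : ¬ P.IsLast i) (hn : ¬ P.IsLast (P.next i h)) (τ : Fin n → Fin 3 → Gen) :
    P.labelFactor g i τ =
      vertexFactor g i (τ i) * kappa (τ i 2) (τ (P.next i h) 0) := by
  simp [labelFactor, h, hf, spineFactor, rightEnd, leftEnd, hn, halfLabel,
    JacobiDiagram.edgeWeight]

/-- The factors of a label depend only on the states at its part. -/
theorem labelFactor_update (g : Fin n → Gen) {i k : Fin n} (hk : k ∉ P.part i)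
    (τ : Fin n → Fin 3 → Gen) (v : Fin 3 → Gen) :
    P.labelFactor g i (Function.update τ k v) = P.labelFactor g i τ := by
  have hi : Function.update τ k v i = τ i :=
    Function.update_of_ne (by rintro rfl; exact hk (P.self_mem _)) _ _
  by_cases hl : P.IsLast i
  · rw [labelFactor_last hl, labelFactor_last hl]
  have hn : Function.update τ k v (P.next i hl) = τ (P.next i hl) :=
    Function.update_of_ne (by rintro rfl; exact hk (P.next_mem i hl).1) _ _
  by_cases hf : P.IsFirst i <;> by_cases hnl : P.IsLast (P.next i hl)
  · rw [labelFactor_first_last hf hl hnl, labelFactor_first_last hf hl hnl]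
  · rw [labelFactor_first_inner hf hl hnl, labelFactor_first_inner hf hl hnl, hn]
  · rw [labelFactor_inner_last hf hl hnl, labelFactor_inner_last hf hl hnl, hi]
  · rw [labelFactor_inner_inner hf hl hnl, labelFactor_inner_inner hf hl hnl, hi, hn]

/-- Neighbours in the increasing list of the elements of a part are related by `next`. -/
theorem isChain_sort_part (i : Fin n) :
    (P.part i).sort.IsChain fun j k => ∃ h : ¬ P.IsLast j, P.next j h = k := by
  rw [List.isChain_iff_forall_rel_of_append_cons_cons]
  intro j k l₁ l₂ hl
  have hs : (l₁ ++ j :: k :: l₂).Pairwise (· < ·) := hl ▸ (Finset.sortedLT_sort _).pairwise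
  have hmem : ∀ x, x ∈ P.part i ↔ x ∈ l₁ ++ j :: k :: l₂ := fun x => by
    rw [← hl, Finset.mem_sort]
  have hj : P.part j = P.part i := P.part_eq ((hmem j).2 (by simp))
  have hk : k ∈ P.part j := by rw [hj]; exact (hmem k).2 (by simp)
  simp only [List.pairwise_append, List.pairwise_cons, List.mem_cons] at hs
  obtain ⟨-, ⟨h1, h2, -⟩, h3⟩ := hs
  have hjk : j < k := h1 k (Or.inl rfl)
  have hlast : ¬ P.IsLast j := fun h => absurd (h k hk) (not_le.2 hjk)
  refine ⟨hlast, le_antisymm (P.next_le j hlast hk hjk) ?_⟩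
  obtain ⟨h4, h5⟩ := P.next_mem j hlast
  rw [hj, hmem] at h4
  simp only [List.mem_append, List.mem_cons] at h4
  rcases h4 with h4 | h4 | h4 | h4
  · exact absurd (h3 _ h4 j (Or.inl rfl)) h5.not_gt
  · exact absurd h4 h5.ne'
  · exact h4.ge
  · exact (h2 _ h4).le

end RiordanPartition

/-! ### Contraction of a linear tree -/

namespace RiordanPartition

variable {n : ℕ} (P : RiordanPartition n)

/-- Summation over the states of the trivalent vertices to the right of a given trivalent vertex
`i`. -/
theorem sumOver_spine (g : Fin n → Gen) {i b : Fin n} (m : List (Fin n))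
    (hc : (i :: (m ++ [b])).IsChain fun j k => ∃ h : ¬ P.IsLast j, P.next j h = k)
    (hd : (i :: m).Nodup) (hi : ¬ P.IsFirst i) (hm : ∀ j ∈ m, ¬ P.IsLast j) (hb : P.IsLast b)
    (τ : Fin n → Fin 3 → Gen) :
    sumOver m (fun τ => ((i :: (m ++ [b])).map fun j => P.labelFactor g j τ).prod) τ =
      vertexFactor g i (τ i) * (m.map fun j => vertexW (g j)).prod (τ i 2) (g b) := by
  induction m generalizing i τ with
  | nil =>
    obtain ⟨⟨h, rfl⟩, -⟩ := List.isChain_cons_cons.1 hc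
    simp only [sumOver, List.nil_append, List.map_cons, List.map_nil, List.prod_cons, List.prod_nil,
      labelFactor_last hb, labelFactor_inner_last hi h hb, Matrix.one_apply, mul_one]
  | cons j m ih =>
    obtain ⟨⟨h, rfl⟩, hc'⟩ := List.isChain_cons_cons.1 hc
    set j := P.next i h with hj
    have hjl : ¬ P.IsLast j := hm j List.mem_cons_self
    obtain ⟨hid, hd'⟩ := List.nodup_cons.1 hd
    have hij : i ≠ j := fun he => hid (he ▸ List.mem_cons_self)
    have hfac : ∀ τ : Fin n → Fin 3 → Gen, P.labelFactor g i τ =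
      vertexFactor g i (τ i) * kappa (τ i 2) (τ j 0) := labelFactor_inner_inner hi h hjl
    -- The factor of `i` involves no state to the right of `j`.
    have hconst : ∀ (t : Fin n → Fin 3 → Gen), ∀ k ∈ m, ∀ a,
        P.labelFactor g i (Function.update t k a) = P.labelFactor g i t := by
      intro t k hk a
      have h1 : i ≠ k := fun he => hid (he ▸ List.mem_cons_of_mem _ hk)
      have h2 : j ≠ k := fun he => (List.nodup_cons.1 hd').1 (he ▸ hk)
      rw [hfac, hfac, Function.update_of_ne h1, Function.update_of_ne h2]
    have hstep : ∀ v : Fin 3 → Gen, sumOver m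
        (fun τ => ((i :: (j :: m ++ [b])).map fun j => P.labelFactor g j τ).prod)
          (Function.update τ j v) =
        vertexFactor g i (τ i) * (kappa (τ i 2) (v 0) * bracketTensor (v 0) (v 1) (v 2) *
          (if v 1 = g j then 1 else 0) *
          (m.map fun j => vertexW (g j)).prod (v 2) (g b)) := by
      intro v
      simp only [List.map_cons (a := i), List.prod_cons (a := P.labelFactor g i _)]
      rw [sumOver_mul_left hconst, hfac, List.cons_append,
        ih hc' hd' (P.next_not_first i h) (fun k hk => hm k (List.mem_cons_of_mem _ hk)),
        Function.update_of_ne hij, Function.update_self, vertexFactor, vertexFactor]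
      ring
    simp only [sumOver, hstep]
    rw [← Finset.mul_sum, sum_fin_three fun p x s => kappa (τ i 2) p * bracketTensor p x s *
      (if x = g j then 1 else 0) * (m.map fun j => vertexW (g j)).prod s (g b)]
    congr 1
    rw [List.map_cons, List.prod_cons, Matrix.mul_apply]
    simp only [vertexW, Matrix.of_apply, Finset.sum_mul]
    refine Eq.trans ?_ Finset.sum_comm
    refine Finset.sum_congr rfl fun p _ => ?_
    rw [Finset.sum_eq_single (g j)]
    · simp
    · intro x _ hx
      simp [hx]
    · simp

/-- The labels of the trivalent vertices of the part of `i`, in increasing order. -/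
def innerList (i : Fin n) : List (Fin n) :=
  (P.part i).sort.filter fun j => ¬ P.IsFirst j ∧ ¬ P.IsLast j

/-- The shape of the part that begins with `i`. -/
theorem exists_sort_part {i : Fin n} (h : P.IsFirst i) : ∃ b,
    P.IsLast b ∧ (P.part i).sort = i :: (P.innerList i ++ [b]) ∧
      ∀ j ∈ P.innerList i, ¬ P.IsFirst j ∧ ¬ P.IsLast j := by
  obtain ⟨a, m, b, hl⟩ := exists_ends (l := (P.part i).sort)
    (by rw [Finset.length_sort]; exact P.two_le_card_part i)
  have hs : (a :: (m ++ [b])).Pairwise (· < ·) := hl ▸ (Finset.sortedLT_sort _).pairwise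
  have hmem : ∀ x, x ∈ P.part i ↔ x ∈ a :: (m ++ [b]) := fun x => by
    rw [← hl, Finset.mem_sort]
  have hpart : ∀ x, x ∈ a :: (m ++ [b]) → P.part x = P.part i := fun x hx =>
    P.part_eq ((hmem x).2 hx)
  simp only [List.pairwise_append, List.pairwise_cons, List.mem_append, List.mem_singleton] at hs
  obtain ⟨h1, -, -, h2⟩ := hs
  have ha : a = i := by
    have hi := (hmem i).1 (P.self_mem i)
    simp only [List.mem_cons, List.mem_append, List.not_mem_nil, or_false] at hi
    rcases hi with hi | hi
    · exact hi.symm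
    · exact absurd (h a ((hmem a).2 (by simp))) (not_le.2 (h1 i hi))
  subst ha
  have hb : P.IsLast b := by
    intro k hk
    rw [hpart b (by simp), hmem] at hk
    simp only [List.mem_cons, List.mem_append, List.not_mem_nil, or_false] at hk
    rcases hk with rfl | hk | rfl
    · exact (h1 b (Or.inr rfl)).le
    · exact (h2 k hk b rfl).le
    · exact le_rfl
  have hm : ∀ j ∈ m, ¬ P.IsFirst j ∧ ¬ P.IsLast j := by
    intro j hj
    have hp := hpart j (by simp [hj])
    refine ⟨fun hf => ?_, fun hf => ?_⟩
    · exact absurd (hf a (by rw [hp]; exact P.self_mem a)) (not_le.2 (h1 j (Or.inl hj)))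
    · exact absurd (hf b (by rw [hp]; exact (hmem b).2 (by simp))) (not_le.2 (h2 j hj b rfl))
  have hin : P.innerList a = m := by
    rw [innerList, hl, List.filter_cons_of_neg (by simp [h]), List.filter_append,
      List.filter_eq_self.2 (by simpa using hm)]
    simp [hb]
  exact ⟨b, hb, by rw [hin, hl], hin ▸ hm⟩

/-- The contraction of one tree of the Riordan tree. -/
theorem sumOver_part (g : Fin n → Gen) {i : Fin n} (h : P.IsFirst i) (τ : Fin n → Fin 3 → Gen) :
    sumOver (P.innerList i)
      (fun τ => ((P.part i).sort.map fun j => P.labelFactor g j τ).prod) τ =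
      chain strutW vertexW (P.partWord g i) := by
  obtain ⟨b, hb, hl, hin⟩ := P.exists_sort_part h
  have hc := P.isChain_sort_part i
  have hd : (P.part i).sort.Nodup := Finset.sort_nodup _ _
  rw [partWord]
  rw [hl] at hc hd ⊢
  generalize P.innerList i = m at *
  rw [List.map_cons, List.map_append, List.map_cons, List.map_nil, chain_eq, List.map_map]
  cases m with
  | nil =>
    obtain ⟨⟨h', rfl⟩, -⟩ := List.isChain_cons_cons.1 hc
    simp [sumOver, labelFactor_last hb, labelFactor_first_last h h' hb]
  | cons j m =>
    obtain ⟨⟨h', rfl⟩, hc'⟩ := List.isChain_cons_cons.1 hc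
    set j := P.next i h' with hj
    obtain ⟨hid, hd'⟩ := List.nodup_cons.1 hd
    have hdm : (j :: m).Nodup := (List.nodup_append.1 hd').1
    have hfac : ∀ τ : Fin n → Fin 3 → Gen, P.labelFactor g i τ = if g i = τ j 0 then 1 else 0 :=
      labelFactor_first_inner h h' (hin j List.mem_cons_self).2
    -- The factor of `i` involves no state to the right of `j`.
    have hconst : ∀ (t : Fin n → Fin 3 → Gen), ∀ k ∈ m, ∀ a,
        P.labelFactor g i (Function.update t k a) = P.labelFactor g i t := by
      intro t k hk a
      have h2 : j ≠ k := fun he => (List.nodup_cons.1 hdm).1 (he ▸ hk)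
      rw [hfac, hfac, Function.update_of_ne h2]
    have hstep : ∀ v : Fin 3 → Gen, sumOver m
        (fun τ => ((i :: (j :: m ++ [b])).map fun j => P.labelFactor g j τ).prod)
          (Function.update τ j v) =
        (if g i = v 0 then 1 else 0) * bracketTensor (v 0) (v 1) (v 2) *
          (if v 1 = g j then 1 else 0) *
          (m.map fun j => vertexW (g j)).prod (v 2) (g b) := by
      intro v
      simp only [List.map_cons (a := i), List.prod_cons (a := P.labelFactor g i _)]
      rw [sumOver_mul_left hconst, hfac, List.cons_append,
        P.sumOver_spine g m hc' hdm (P.next_not_first i h')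
          (fun k hk => (hin k (List.mem_cons_of_mem _ hk)).2) hb,
        Function.update_self, vertexFactor]
      ring
    simp only [sumOver, hstep]
    rw [sum_fin_three fun p x s => (if g i = p then 1 else 0) * bracketTensor p x s *
      (if x = g j then 1 else 0) * (m.map fun j => vertexW (g j)).prod s (g b)]
    rw [List.map_cons, List.prod_cons, ← Matrix.mul_assoc, Matrix.mul_apply]
    simp only [Function.comp_apply, strutW_mul_vertexW]
    rw [Finset.sum_eq_single (g i), Finset.sum_eq_single (g j)]
    · simp [Function.comp_def]
    · intro x _ hx
      simp [hx]
    · simp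
    · intro p _ hp
      simp [hp.symm]
    · simp

end RiordanPartition

theorem prod_map_sort {α R : Type*} [LinearOrder α] [CommMonoid R] (S : Finset α) (f : α → R) :
    (S.sort.map f).prod = ∏ j ∈ S, f j := by
  rw [Finset.prod_eq_multiset_prod, ← Finset.sort_eq S (· ≤ ·)]
  rfl

/-! ### Contraction of the whole tree -/

namespace RiordanPartition

variable {n : ℕ} (P : RiordanPartition n)

theorem exists_isFirst (i : Fin n) : ∃ j, P.IsFirst j ∧ i ∈ P.part j := by
  have hne : (P.part i).Nonempty := ⟨i, P.self_mem i⟩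
  have hmem := Finset.min'_mem _ hne
  have hp := P.part_eq hmem
  refine ⟨(P.part i).min' hne, fun k hk => ?_, by rw [hp]; exact P.self_mem i⟩
  rw [hp] at hk
  exact Finset.min'_le _ _ hk

theorem eq_of_mem_part {i j k : Fin n} (hi : P.IsFirst i) (hj : P.IsFirst j) (hki : k ∈ P.part i)
    (hkj : k ∈ P.part j) : i = j := by
  have h : P.part i = P.part j := (P.part_eq hki).symm.trans (P.part_eq hkj)
  exact le_antisymm (hi j (by rw [h]; exact P.self_mem j))
    (hj i (by rw [← h]; exact P.self_mem i))

/-- The smallest elements of the parts; they index the parts. -/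
def firsts : Finset (Fin n) := Finset.univ.filter P.IsFirst

theorem mem_firsts {i : Fin n} : i ∈ P.firsts ↔ P.IsFirst i := by simp [firsts]

theorem prod_firsts_prod_part {R : Type*} [CommMonoid R] (f : Fin n → R) :
    ∏ i ∈ P.firsts, ∏ j ∈ P.part i, f j = ∏ j, f j := by
  rw [← Finset.prod_biUnion]
  · congr 1
    refine Finset.eq_univ_iff_forall.2 fun j => ?_
    obtain ⟨i, hi, hj⟩ := P.exists_isFirst j
    exact Finset.mem_biUnion.2 ⟨i, P.mem_firsts.2 hi, hj⟩
  · intro i hi j hj hij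
    refine Finset.disjoint_left.2 fun k hki hkj => hij ?_
    exact P.eq_of_mem_part (P.mem_firsts.1 hi) (P.mem_firsts.1 hj) hki hkj

/-- The labels of all the trivalent vertices, part by part. -/
noncomputable def allInner : List (Fin n) := P.firsts.toList.flatMap P.innerList

theorem mem_innerList {i j : Fin n} :
    j ∈ P.innerList i ↔ j ∈ P.part i ∧ ¬ P.IsFirst j ∧ ¬ P.IsLast j := by
  simp [innerList]

theorem mem_allInner {j : Fin n} : j ∈ P.allInner ↔ ¬ P.IsFirst j ∧ ¬ P.IsLast j := by
  simp only [allInner, List.mem_flatMap, Finset.mem_toList, mem_firsts, mem_innerList]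
  refine ⟨fun ⟨_, _, _, h⟩ => h, fun h => ?_⟩
  obtain ⟨i, hi, hj⟩ := P.exists_isFirst j
  exact ⟨i, hi, hj, h⟩

theorem nodup_allInner : P.allInner.Nodup := by
  rw [allInner, List.nodup_flatMap]
  refine ⟨fun i _ => (Finset.sort_nodup _ _).filter _, ?_⟩
  refine (Finset.nodup_toList P.firsts).imp_of_mem fun {i j} hi hj hij => ?_
  rw [Function.onFun, List.disjoint_left]
  intro k hki hkj
  exact hij (P.eq_of_mem_part (P.mem_firsts.1 (Finset.mem_toList.1 hi))
    (P.mem_firsts.1 (Finset.mem_toList.1 hj)) (P.mem_innerList.1 hki).1 (P.mem_innerList.1 hkj).1)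

theorem length_innerList {i : Fin n} (h : P.IsFirst i) :
    (P.innerList i).length + 2 = (P.part i).card := by
  obtain ⟨b, -, hl, -⟩ := P.exists_sort_part h
  have := congrArg List.length hl
  rw [Finset.length_sort] at this
  simp at this
  omega

theorem tri_eq_sum : P.tree.tri = ∑ i ∈ P.firsts, (P.innerList i).length := by
  have h : P.tree.tri = P.allInner.length := by
    change Fintype.card P.Inner = _
    rw [Fintype.card_subtype, ← List.toFinset_card_of_nodup P.nodup_allInner]
    congr 1
    ext j
    simp [mem_allInner]
  rw [h, allInner, List.length_flatMap, Finset.sum_map_toList]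

/-- The trees of the different parts are contracted independently. -/
theorem sumOver_parts (g : Fin n → Gen) (Q : List (Fin n)) (hQ : Q.Nodup)
    (hf : ∀ i ∈ Q, P.IsFirst i) (τ : Fin n → Fin 3 → Gen) :
    sumOver (Q.flatMap P.innerList) (fun τ => (Q.map fun i =>
      ((P.part i).sort.map fun j => P.labelFactor g j τ).prod).prod) τ =
      (Q.map fun i => chain strutW vertexW (P.partWord g i)).prod := by
  induction Q generalizing τ with
  | nil => rfl
  | cons i Q ih =>
    obtain ⟨hi, hQ⟩ := List.nodup_cons.1 hQ
    have hfi := hf i List.mem_cons_self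
    have hconst : ∀ (t : Fin n → Fin 3 → Gen), ∀ k ∈ Q.flatMap P.innerList, ∀ a,
        ((P.part i).sort.map fun j => P.labelFactor g j (Function.update t k a)).prod =
          ((P.part i).sort.map fun j => P.labelFactor g j t).prod := by
      intro t k hk a
      congr 1
      refine List.map_congr_left fun j hj => P.labelFactor_update g ?_ t a
      rw [P.part_eq ((Finset.mem_sort _).1 hj)]
      intro hki
      obtain ⟨l, hl, hkl⟩ := List.mem_flatMap.1 hk
      have := P.eq_of_mem_part hfi (hf l (List.mem_cons_of_mem _ hl)) hki
        (P.mem_innerList.1 hkl).1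
      exact hi (this ▸ hl)
    rw [List.flatMap_cons, sumOver_append]
    simp only [List.map_cons, List.prod_cons]
    have hin : sumOver (Q.flatMap P.innerList) (fun τ =>
        ((P.part i).sort.map fun j => P.labelFactor g j τ).prod * (Q.map fun i =>
          ((P.part i).sort.map fun j => P.labelFactor g j τ).prod).prod) = fun τ =>
        (Q.map fun i => chain strutW vertexW (P.partWord g i)).prod *
          ((P.part i).sort.map fun j => P.labelFactor g j τ).prod := by
      funext t
      rw [sumOver_mul_left hconst, ih hQ fun j hj => hf j (List.mem_cons_of_mem _ hj), mul_comm]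
    rw [hin, sumOver_mul_left (fun _ _ _ _ => rfl), P.sumOver_part g hfi, mul_comm]

/-- The coefficient of a labelling of the half-edges in the weight, as a product over the labels. -/
theorem prod_eq_prod_labelFactor (g : Fin n → Gen) (τ : Fin n → Fin 3 → Gen) :
    ((∏ x : P.tree.Tri, bracketTensor (P.halfLabel g τ (.inl (x, 0)))
        (P.halfLabel g τ (.inl (x, 1))) (P.halfLabel g τ (.inl (x, 2)))) *
      ∏ t : P.tree.Edge, P.tree.edgeWeight (P.tree.ends (t, false)) (P.tree.ends (t, true))
        (P.halfLabel g τ (P.tree.ends (t, false))) (P.halfLabel g τ (P.tree.ends (t, true)))) =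
      ∏ i, P.labelFactor g i τ := by
  have h1 : (∏ t : P.tree.Edge, P.tree.edgeWeight (P.tree.ends (t, false)) (P.tree.ends (t, true))
        (P.halfLabel g τ (P.tree.ends (t, false))) (P.halfLabel g τ (P.tree.ends (t, true)))) =
      (∏ x : P.Inner, if τ x.1 1 = g x.1 then 1 else 0) *
        ∏ i : {i : Fin n // ¬ P.IsLast i}, P.spineFactor g i.1 i.2 τ :=
    Fintype.prod_sum_type _
  have h2 : ∏ x : P.Inner, vertexFactor g x.1 (τ x.1) =
      ∏ i, if ¬ P.IsFirst i ∧ ¬ P.IsLast i then vertexFactor g i (τ i) else 1 := by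
    rw [← Finset.prod_filter]
    exact (Finset.prod_subtype _ (by simp) fun i => vertexFactor g i (τ i)).symm
  have h3 : ∏ i : {i : Fin n // ¬ P.IsLast i}, P.spineFactor g i.1 i.2 τ =
      ∏ i, if h : ¬ P.IsLast i then P.spineFactor g i h τ else 1 := by
    rw [← Finset.prod_filter_of_ne (p := fun i => ¬ P.IsLast i)
      fun i _ hne hl => hne (dif_neg (not_not.2 hl)),
      Finset.prod_subtype (p := fun i => ¬ P.IsLast i) _ (by simp)]
    exact Finset.prod_congr rfl fun i _ => by rw [dif_pos i.2]
  rw [h1, h3, ← mul_assoc]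
  simp only [labelFactor, Finset.prod_mul_distrib]
  rw [← h2]
  simp only [vertexFactor, Finset.prod_mul_distrib]
  rfl

/-- The `sl₂` weight of a Riordan tree in coordinates. -/
theorem weight_tree : P.tree.weight = ∑ g : Fin n → Gen,
    (∏ i ∈ P.firsts, chain strutW vertexW (P.partWord g i)) • ⨂ₜ[ℂ] i, gen (g i) := by
  have hsum : ∀ g : Fin n → Gen, (∑ τ : P.Inner → Fin 3 → Gen,
      ((∏ x : P.tree.Tri, bracketTensor (τ x 0) (τ x 1) (τ x 2)) *
        ∏ t : P.tree.Edge, P.tree.edgeWeight (P.tree.ends (t, false)) (P.tree.ends (t, true))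
          (Sum.elim (fun p => τ p.1 p.2) g (P.tree.ends (t, false)))
          (Sum.elim (fun p => τ p.1 p.2) g (P.tree.ends (t, true))))) =
      ∏ i ∈ P.firsts, chain strutW vertexW (P.partWord g i) := by
    intro g
    rw [sum_subtype_eq_sumOver P.nodup_allInner (fun _ => P.mem_allInner) _ (fun _ _ => .h)]
    have h1 := P.sumOver_parts g P.firsts.toList (Finset.nodup_toList _)
      (fun i hi => P.mem_firsts.1 (Finset.mem_toList.1 hi)) (fun _ _ => .h)
    rw [Finset.prod_map_toList] at h1
    rw [← h1]
    change sumOver P.allInner _ _ = sumOver P.allInner _ _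
    congr 1
    funext τ
    refine (P.prod_eq_prod_labelFactor g τ).trans ?_
    rw [Finset.prod_map_toList, ← P.prod_firsts_prod_part]
    simp only [prod_map_sort]
  simp only [← hsum]
  unfold JacobiDiagram.weight
  rw [← (Equiv.sumArrowEquivProdArrow (P.tree.Tri × Fin 3) (Fin n) Gen).symm.sum_comp,
    Fintype.sum_prod_type, Finset.sum_comm]
  refine Finset.sum_congr rfl fun g _ => ?_
  rw [← (Equiv.curry P.tree.Tri (Fin 3) Gen).symm.sum_comp, Finset.sum_smul]
  rfl

end RiordanPartition

/-! ### Specialization at `q = 1` -/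

/-- The rational function `r` is regular at `q = 1` and takes the value `z` there. -/
def HasValueAtOne (r : Kq) (z : ℂ) : Prop := RegularAtOne r ∧ valueAtOne r = z

namespace HasValueAtOne

theorem add {r r' : Kq} {z z' : ℂ} (h : HasValueAtOne r z) (h' : HasValueAtOne r' z') :
    HasValueAtOne (r + r') (z + z') := by
  refine ⟨regular_add h.1 h'.1, ?_⟩
  rw [← h.2, ← h'.2]
  exact RatFunc.eval_add _ _ h.1 h'.1

theorem mul {r r' : Kq} {z z' : ℂ} (h : HasValueAtOne r z) (h' : HasValueAtOne r' z') :
    HasValueAtOne (r * r') (z * z') := by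
  refine ⟨regular_mul h.1 h'.1, ?_⟩
  rw [← h.2, ← h'.2]
  exact RatFunc.eval_mul _ _ h.1 h'.1

theorem zero : HasValueAtOne 0 0 := ⟨regular_zero, value_zero⟩

theorem one : HasValueAtOne 1 1 := ⟨regular_one, value_one⟩

theorem neg {r : Kq} {z : ℂ} (h : HasValueAtOne r z) : HasValueAtOne (-r) (-z) := by
  have h1 : HasValueAtOne (RatFunc.C (-1)) (-1) := ⟨regular_C _, by
    rw [valueAtOne, RatFunc.eval_C]; rfl⟩
  simpa using h1.mul h

theorem inv {r : Kq} {z : ℂ} (h : HasValueAtOne r z) (hz : z ≠ 0) : HasValueAtOne r⁻¹ z⁻¹ := by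
  have := regular_inv h.1 (by rw [h.2]; exact hz)
  exact ⟨this.1, by rw [this.2, h.2]⟩

theorem pow {r : Kq} {z : ℂ} (h : HasValueAtOne r z) (k : ℕ) : HasValueAtOne (r ^ k) (z ^ k) := by
  induction k with
  | zero => simpa using one
  | succ k ih => rw [pow_succ, pow_succ]; exact ih.mul h

theorem sum {ι : Type*} (S : Finset ι) {r : ι → Kq} {z : ι → ℂ}
    (h : ∀ i, HasValueAtOne (r i) (z i)) : HasValueAtOne (∑ i ∈ S, r i) (∑ i ∈ S, z i) := by
  have := regular_sum S r fun i => (h i).1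
  exact ⟨this.1, by rw [this.2]; exact Finset.sum_congr rfl fun i _ => (h i).2⟩

theorem prod {ι : Type*} (S : Finset ι) {r : ι → Kq} {z : ι → ℂ}
    (h : ∀ i ∈ S, HasValueAtOne (r i) (z i)) : HasValueAtOne (∏ i ∈ S, r i) (∏ i ∈ S, z i) := by
  classical
  induction S using Finset.induction_on with
  | empty => simpa using one
  | insert a S ha ih =>
    rw [Finset.prod_insert ha, Finset.prod_insert ha]
    exact (h a (by simp)).mul (ih fun i hi => h i (Finset.mem_insert_of_mem hi))

end HasValueAtOne

theorem hasValueAtOne_q : HasValueAtOne q 1 := ⟨regular_q, value_q⟩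

theorem hasValueAtOne_q_inv : HasValueAtOne q⁻¹ 1 := by
  simpa using hasValueAtOne_q.inv one_ne_zero

theorem hasValueAtOne_qInt_two_inv : HasValueAtOne (q + q⁻¹)⁻¹ 2⁻¹ :=
  HasValueAtOne.inv regular_qInt_two two_ne_zero

/-- The basis element of `sl₂` to which `ρ` sends the line of `v^w`. -/
def wtGen : Wt ≃ Gen where
  toFun
    | .two => .e
    | .zero => .h
    | .negTwo => .f
  invFun
    | .e => .two
    | .h => .zero
    | .f => .negTwo
  left_inv w := by cases w <;> rfl
  right_inv g := by cases g <;> rfl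

/-- The scalars in `ρ(v²) = -e`, `ρ(v⁰) = ½ h`, `ρ(v⁻²) = f`. -/
noncomputable def rhoScalar : Wt → ℂ
  | .two => -1
  | .zero => 1 / 2
  | .negTwo => 1

theorem rhoVec_eq (w : Wt) : rhoVec w = rhoScalar w • gen (wtGen w) := by
  cases w <;> simp [rhoVec, rhoScalar, wtGen]

theorem rhoScalar_ne_zero (w : Wt) : rhoScalar w ≠ 0 := by
  cases w <;> simp [rhoScalar]

/-- `ρ` sends the quantum strut to `-c`. -/
theorem hasValueAtOne_strutQ (a b : Wt) : HasValueAtOne (strutQ a b)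
    (-((rhoScalar a)⁻¹ * (rhoScalar b)⁻¹ * strutW (wtGen a) (wtGen b))) := by
  have hz : ∀ {r z z'}, HasValueAtOne r z → z = z' → HasValueAtOne r z' := fun h e => e ▸ h
  have h00 : HasValueAtOne (-q⁻¹ * (1 + q⁻¹ ^ 2)) (-1 * (1 + 1 ^ 2)) :=
    hasValueAtOne_q_inv.neg.mul (HasValueAtOne.one.add (hasValueAtOne_q_inv.pow 2))
  cases a <;> cases b <;> first
    | exact hz HasValueAtOne.zero (by simp [strutW, casimir, wtGen])
    | exact hz HasValueAtOne.one (by simp [strutW, casimir, wtGen, rhoScalar])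
    | exact hz (hasValueAtOne_q_inv.pow 2) (by simp [strutW, casimir, wtGen, rhoScalar])
    | exact hz h00 (by simp [strutW, casimir, wtGen, rhoScalar]; norm_num)

/-- `ρ` sends the quantum vertex to `-½ b`, contracted by `κ`. -/
theorem hasValueAtOne_vertexQ (x t y : Wt) : HasValueAtOne (vertexQ x t y)
    (-(1 / 2) * (rhoScalar x)⁻¹ * (rhoScalar y)⁻¹ * rhoScalar t *
      vertexW (wtGen x) (wtGen t) (wtGen y)) := by
  have hz : ∀ {r z z'}, HasValueAtOne r z → z = z' → HasValueAtOne r z' := fun h e => e ▸ h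
  have h00 : HasValueAtOne ((q + q⁻¹)⁻¹ * (q - q⁻¹ ^ 3)) (2⁻¹ * (1 + -1 ^ 3)) := by
    rw [sub_eq_add_neg]
    exact hasValueAtOne_qInt_two_inv.mul (hasValueAtOne_q.add (hasValueAtOne_q_inv.pow 3).neg)
  cases x <;> cases t <;> cases y <;> first
    | exact hz HasValueAtOne.zero
        (by simp [vertexW, sum_gen, kappa, bracketTensor, wtGen])
    | exact hz HasValueAtOne.one
        (by simp [vertexW, sum_gen, kappa, bracketTensor, wtGen, rhoScalar])
    | exact hz (hasValueAtOne_q_inv.pow 2).neg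
        (by simp [vertexW, sum_gen, kappa, bracketTensor, wtGen, rhoScalar])
    | exact hz hasValueAtOne_qInt_two_inv
        (by simp [vertexW, sum_gen, kappa, bracketTensor, wtGen, rhoScalar])
    | exact hz hasValueAtOne_qInt_two_inv.neg
        (by simp [vertexW, sum_gen, kappa, bracketTensor, wtGen, rhoScalar])
    | exact hz h00 (by simp [vertexW, sum_gen, kappa, bracketTensor, wtGen])

theorem hasValueAtOne_chain {k : ℕ} (w : List Wt) (hw : w.length = k + 2) :
    HasValueAtOne (chain strutQ vertexQ w)
      (-(-(1 / 2)) ^ k * (w.map fun a => (rhoScalar a)⁻¹).prod *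
        chain strutW vertexW (w.map wtGen)) := by
  induction k generalizing w with
  | zero =>
    match w, hw with
    | [a, b], _ =>
      have h := hasValueAtOne_strutQ a b
      simpa [chain_pair] using h
  | succ k ih =>
    obtain ⟨a, m, x, b, rfl⟩ := exists_snoc_pair hw
    rw [chain_snoc]
    have h := HasValueAtOne.sum Finset.univ fun t =>
      (ih (a :: (m ++ [t])) (by simpa using hw)).mul (hasValueAtOne_vertexQ x t b)
    convert h using 1
    simp only [List.map_cons, List.map_append, List.map_nil]
    rw [chain_snoc, sum_gen, sum_wt]
    have h1 := rhoScalar_ne_zero .two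
    have h2 := rhoScalar_ne_zero .zero
    have h3 := rhoScalar_ne_zero .negTwo
    simp only [List.prod_cons, List.prod_append, List.prod_nil, wtGen, Equiv.coe_fn_mk]
    -- The scalars at the summation index `t` cancel between the tree and the last vertex.
    field_simp
    ring

namespace RiordanPartition

variable {n : ℕ} (P : RiordanPartition n)

theorem deg_tree : P.tree.deg = P.tree.tri + P.firsts.card := by
  have h1 := P.tree.two_mul_deg
  -- The parts cover all labels; a part with `k` trivalent vertices has `k + 2` elements.
  have h2 : ∑ i ∈ P.firsts, ((P.innerList i).length + 2) = n := by
    rw [Finset.sum_congr rfl fun i hi => P.length_innerList (P.mem_firsts.1 hi)]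
    have h := P.prod_firsts_prod_part (R := Multiplicative ℕ) fun _ => Multiplicative.ofAdd 1
    have h' : ∑ i ∈ P.firsts, ∑ j ∈ P.part i, 1 = ∑ j : Fin n, 1 := h
    simpa using h'
  rw [Finset.sum_add_distrib, ← P.tri_eq_sum, Finset.sum_const, smul_eq_mul] at h2
  omega

theorem hasValueAtOne_coord_fElement (s : Fin n → Wt) : HasValueAtOne (coord (fElement P) s)
    ((-1) ^ P.tree.deg / 2 ^ P.tree.tri * (∏ i, (rhoScalar (s i))⁻¹) *
      ∏ i ∈ P.firsts, chain strutW vertexW (P.partWord (fun i => wtGen (s i)) i)) := by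
  rw [coord_fElement, ← firsts]
  have h := HasValueAtOne.prod P.firsts fun i hi => hasValueAtOne_chain (P.partWord s i)
    (k := (P.innerList i).length)
    (by rw [length_partWord, P.length_innerList (P.mem_firsts.1 hi)])
  convert h using 1
  rw [Finset.prod_mul_distrib, Finset.prod_mul_distrib]
  congr 1
  · congr 1
    · rw [P.deg_tree, Finset.prod_neg, Finset.prod_pow_eq_pow_sum, ← P.tri_eq_sum, pow_add,
        neg_pow (1 / 2 : ℂ), one_div, inv_pow]
      ring
    · rw [← P.prod_firsts_prod_part]
      refine Finset.prod_congr rfl fun i _ => ?_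
      rw [partWord, List.map_map, prod_map_sort]
      rfl
  · refine Finset.prod_congr rfl fun i _ => ?_
    rw [partWord, partWord, List.map_map]
    rfl

theorem rhoTensor_fElement : rhoTensor (fElement P) =
    ((-1 : ℂ) ^ P.tree.deg / 2 ^ P.tree.tri) • P.tree.weight := by
  rw [rhoTensor, weight_tree, Finset.smul_sum,
    ← (Equiv.piCongrRight fun _ : Fin n => wtGen).sum_comp]
  refine Finset.sum_congr rfl fun s _ => ?_
  rw [(P.hasValueAtOne_coord_fElement s).2]
  simp only [rhoVec_eq, Equiv.piCongrRight_apply, Pi.map_apply]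
  rw [MultilinearMap.map_smul_univ, smul_smul, smul_smul]
  congr 1
  have h : (∏ i, (rhoScalar (s i))⁻¹) * ∏ i, rhoScalar (s i) = 1 := by
    rw [← Finset.prod_mul_distrib]
    exact Finset.prod_eq_one fun i _ => inv_mul_cancel₀ (rhoScalar_ne_zero _)
  rw [mul_right_comm, mul_assoc (_ / _), h, mul_one]
  rfl

end RiordanPartition

end RiordanSl2

/-- For the Riordan tree `T` of any Riordan partition `P` of `{1, …, n}`, the tensor `f(T)` is
`U_q(sl₂)`-invariant and regular at `q = 1`, and its specialization is
`ρ(f(T)) = (-1)^{deg T} / 2^{tri T} • W(T)`. -/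
theorem proposition4p3 (n : ℕ) (P : RiordanSl2.RiordanPartition n) :
    ∃ hf : RiordanSl2.fElement P ∈ RiordanSl2.invUqReg n,
      (RiordanSl2.rho n ⟨RiordanSl2.fElement P, hf⟩ : RiordanSl2.Sl2Pow n) =
        ((-1 : ℂ) ^ P.tree.deg / 2 ^ P.tree.tri) • P.tree.weight :=
  ⟨⟨P.fElement_mem_invUq, fun s => (P.hasValueAtOne_coord_fElement s).1⟩,
    P.rhoTensor_fElement⟩
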